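/- **Setting.** Let $(W,S)$ be a Coxeter system with Coxeter matrix $(m_{st})$, $m_{ss}=1$, $m_{st}=\infty$ allowed. Let $\mathfrak h^*=\bigoplus_{s\in S}\mathbb R\alpha_s$ with the symmetric bilinear form $(\alpha_s,\alpha_t)=-\cos(\pi/m_{st})$ (equal to $-1$ if $m_{st}=\infty$), put $\langle\lambda,\alpha_s^\vee\rangle=2(\lambda,\alpha_s)/(\alpha_s,\alpha_s)$, and let $W$ act on $\mathfrak h^*$ by $s(\lambda)=\lambda-\langle\lambda,\alpha_s^\vee\rangle\alpha_s$ and hence on $R=\operatorname{Sym}(\mathfrak h^*)$ by algebra automorphisms. The affine nil Hecke algebra $\mathrm{NH}$ is the $\mathbb R$-algebra generated by the vector space $\mathfrak h^*$ and symbols $\partial_s$ ($s\in S$) with the relations $\lambda\mu=\mu\lambda$, $\partial_s\lambda=s(\lambda)\partial_s+\langle\lambda,\alpha_s^\vee\rangle$, $\partial_s^2=0$, and $\partial_s\partial_t\partial_s\cdots=\partial_t\partial_s\partial_t\cdots$ ($m_{st}$ factors on each side) whenever $m_{st}<\infty$. It receives an algebra morphism from $R$ extending $\mathfrak h^*\to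 \mathrm{NH}$. In $\mathrm{NH}$ write $s:=1-\alpha_s\partial_s$. The twisted group algebra $R\star W$ is the free left $R$-module on $W$ with $(rw)(r'w')=r\,w(r')\,ww'$. **Hopf algebroids.** Let $k$ be a field, $R$ a commutative $k$-algebra and $H\supseteq R$ a $k$-algebra. Write $H\otimes_R H$ for the tensor product of left $R$-modules ($rh\otimes h'=h\otimes rh'$) and $H\boxtimes_R H$ for the balanced one ($hr\boxtimes h'=h\boxtimes rh'$). The Takeuchi products $$H\times_R H=\Big\{\textstyle\sum h_i\otimes h_i'\in H\otimes_R H : \sum h_ir\otimes h_i'=\sum h_i\otimes h_i'r\ \ \forall r\in R\Big\},$$ $$H\times_R^{\boxtimes} H^{\mathrm{op}}=\Big\{\textstyle\sum h_i\boxtimes h_i'\in H\boxtimes_R H : \sum rh_i\boxtimes h_i'=\sum h_i\boxtimes h_i'r\ \ \forall r\in R\Big\}$$ are $k$-algebras under the componentwise products $(h\otimes h')(g\otimes g')=hg\otimes h'g'$ and $(h\boxtimes h')(g\boxtimes g')=hg\boxtimes g'h'$, respectively. A left bialgebroid structure on $H$ over $R$ is a coassociative counital coalgebra structure $(\Delta,\varepsilon)$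 on the left $R$-module $H$ such that $\Delta$ is a $k$-algebra morphism $H\to H\times_RH$, and such that $h\mapsto(r\mapsto\varepsilon(hr))$ is a representation of $H$ on $R$ that restricts to the regular representation of $R$. It is a Hopf algebroid if the Galois map $\mathrm{Gal}\colon H\boxtimes_RH\to H\otimes_RH$, $h\boxtimes h'\mapsto h_{(1)}\otimes h_{(2)}h'$, is bijective; its translation map is $\mathrm{red}(h)=\mathrm{Gal}^{-1}(h\otimes1)$. For example, $R\star W$ carries the coalgebra structure $\Delta(rw)=rw\otimes w$, $\varepsilon(rw)=r$. **Theorem (Nil Hecke bialgebroid).** 1. There is an algebra morphism $\rho\colon \mathrm{NH}\to\operatorname{End}_{\mathbb R}(R)$ such that $\rho(\lambda)$ is multiplication by $\lambda$ for $\lambda\in\mathfrak h^*$, and $\alpha_s\cdot\rho(\partial_s)(f)=f-s(f)$ for $s\in S$, $f\in R$. 2. The assignments $$\Delta(\lambda)=\lambda\cdot 1\otimes 1,\qquad \Delta(\partial_s)=\partial_s\otimes s+1\otimes\partial_s=\partial_s\otimes1+s\otimes\partial_s\qquad(\lambda\in\mathfrak h^*,\ s\in S)$$ extend to an $\mathbb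 R$-algebra morphism $\Delta\colon \mathrm{NH}\to \mathrm{NH}\times_R \mathrm{NH}$. 3. The map $R\to\mathrm{NH}$ is injective, and with $\Delta$ and the counit $\varepsilon(h)=\rho(h)(1)$ the algebra $\mathrm{NH}$ is a Hopf algebroid over $R$ which is cocommutative, i.e. $\Delta$ is invariant under the flip of $\mathrm{NH}\otimes_R\mathrm{NH}$. 4. Its translation map is an $\mathbb R$-algebra morphism $\mathrm{red}\colon \mathrm{NH}\to \mathrm{NH}\times_R^{\boxtimes}\mathrm{NH}^{\mathrm{op}}$, given on generators by $$\mathrm{red}(\lambda)=\lambda\boxtimes1,\qquad \mathrm{red}(\partial_s)=\partial_s\boxtimes s+1\boxtimes\partial_s=\partial_s\boxtimes1-s\boxtimes\partial_s .$$ 5. $R\star W$ is a Hopf subalgebroid of $\mathrm{NH}$: $R\star W$ is a Hopf algebroid over $R$, and there is an injective $R$-linear algebra morphism $R\star W\to \mathrm{NH}$ with $s\mapsto 1-\alpha_s\partial_s$ for $s\in S$, which is compatible with the comultiplications and the counits. -/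

import Mathlib

open scoped TensorProduct

noncomputable section

namespace HopfAlgebroid

/-! ### Tensor products of `R`-bimodules

`H` is a ring with a ring homomorphism from the commutative ring `R`, encoded by a left `R`-module
structure compatible with the multiplication of `H`; the homomorphism is `r ↦ r • 1`.
The tensor product of left modules is `H ⊗[R] H`. -/

section Basic

variable (R H : Type*) [CommRing R] [Ring H] [Module R H] [IsScalarTower R H H]

/-- The structure homomorphism `R → H`, `r ↦ r • 1`. -/
def incl : R →+* H where
  toFun r := r • (1 : H)
  map_one' := one_smul _ _
  map_mul' r r' := by rw [smul_mul_assoc, one_mul, mul_smul]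
  map_zero' := zero_smul _ _
  map_add' r r' := add_smul _ _ _

variable {R H} in
theorem incl_mul (r : R) (h : H) : incl R H r * h = r • h := by
  simp [incl, smul_mul_assoc]

/-- A copy of `H`, on which `R` acts by multiplication from the right. -/
def RightCopy (_R H : Type*) : Type _ := H

/-- An element of `H`, seen in the copy of `H`. -/
def toRight (_R : Type*) {H : Type*} (h : H) : RightCopy _R H := h

/-- An element of the copy of `H`, seen in `H`. -/
def ofRight {_R H : Type*} (h : RightCopy _R H) : H := h

instance : AddCommGroup (RightCopy R H) := inferInstanceAs (AddCommGroup H)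

/-- The right regular action `r • h = h r` of the commutative ring `R`. -/
instance : Module R (RightCopy R H) where
  smul r h := toRight R (ofRight h * incl R H r)
  one_smul h := show ofRight h * incl R H 1 = ofRight h by rw [map_one, mul_one]
  mul_smul r r' h := show ofRight h * incl R H (r * r') =
      ofRight h * incl R H r' * incl R H r by
    rw [mul_comm r r', map_mul, mul_assoc]
  smul_zero r := zero_mul (M₀ := H) (incl R H r)
  smul_add r h h' := add_mul (R := H) (ofRight h) (ofRight h') (incl R H r)
  zero_smul h := show ofRight h * incl R H 0 = 0 by rw [map_zero, mul_zero]
  add_smul r r' h := show ofRight h * incl R H (r + r') =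
      ofRight h * incl R H r + ofRight h * incl R H r' by
    rw [map_add, mul_add]

/-- The balanced tensor product `H_R ⊗_R {}_R H`, in which `h r ⊗ h' = h ⊗ r h'`. -/
abbrev BalTensor : Type _ := RightCopy R H ⊗[R] H

/-- The element `h ⊗ h'` of the balanced tensor product. -/
def balTmul (h h' : H) : BalTensor R H := toRight R h ⊗ₜ[R] h'

/-- Multiplication from the right by `a`, as a map of left `R`-modules. -/
def mulR (a : H) : H →ₗ[R] H where
  toFun h := h * a
  map_add' h h' := add_mul h h' a
  map_smul' r h := smul_mul_assoc r h a

/-- Multiplication from the left by `a`, as a map of right `R`-modules. -/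
def mulL (a : H) : RightCopy R H →ₗ[R] RightCopy R H where
  toFun h := toRight R (a * ofRight h)
  map_add' h h' := mul_add (R := H) a (ofRight h) (ofRight h')
  map_smul' r h := (mul_assoc a (ofRight h) (incl R H r)).symm

/-- The map `h ⊗ h' ↦ h a ⊗ h' b` on `H ⊗[R] H`. -/
def actR (a b : H) : H ⊗[R] H →ₗ[R] H ⊗[R] H := TensorProduct.map (mulR R H a) (mulR R H b)

/-- The map `h ⊗ h' ↦ a h ⊗ h' b` on the balanced tensor product. -/
def actB (a b : H) : BalTensor R H →ₗ[R] BalTensor R H :=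
  TensorProduct.map (mulL R H a) (mulR R H b)

variable {R H}

@[simp] theorem actR_tmul (a b h h' : H) :
    actR R H a b (h ⊗ₜ[R] h') = (h * a) ⊗ₜ[R] (h' * b) := rfl

@[simp] theorem actB_balTmul (a b h h' : H) :
    actB R H a b (balTmul R H h h') = balTmul R H (a * h) (h' * b) := rfl

@[elab_as_elim]
theorem bal_induction {p : BalTensor R H → Prop} (x : BalTensor R H) (zero : p 0)
    (tmul : ∀ h h', p (balTmul R H h h')) (add : ∀ x y, p x → p y → p (x + y)) : p x :=
  TensorProduct.induction_on x zero tmul add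

theorem balTmul_balanced (r : R) (h h' : H) :
    balTmul R H (h * incl R H r) h' = balTmul R H h (r • h') :=
  TensorProduct.smul_tmul (R := R) (M := RightCopy R H) r h h'

theorem balTmul_add_left (a a' b : H) :
    balTmul R H (a + a') b = balTmul R H a b + balTmul R H a' b :=
  TensorProduct.add_tmul (R := R) (M := RightCopy R H) a a' b

theorem balTmul_add_right (a b b' : H) :
    balTmul R H a (b + b') = balTmul R H a b + balTmul R H a b' :=
  TensorProduct.tmul_add (R := R) (M := RightCopy R H) a b b'

theorem actR_add_left (a a' b : H) (x : H ⊗[R] H) :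
    actR R H (a + a') b x = actR R H a b x + actR R H a' b x := by
  induction x with
  | zero => simp
  | tmul h h' => simp [mul_add, TensorProduct.add_tmul]
  | add x y hx hy => simp only [map_add, hx, hy]; abel

theorem actR_add_right (a b b' : H) (x : H ⊗[R] H) :
    actR R H a (b + b') x = actR R H a b x + actR R H a b' x := by
  induction x with
  | zero => simp
  | tmul h h' => simp [mul_add, TensorProduct.tmul_add]
  | add x y hx hy => simp only [map_add, hx, hy]; abel

theorem actR_actR (a b c d : H) (x : H ⊗[R] H) :
    actR R H a b (actR R H c d x) = actR R H (c * a) (d * b) x := by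
  induction x with
  | zero => simp
  | tmul h h' => simp [mul_assoc]
  | add x y hx hy => simp only [map_add, hx, hy]

theorem actR_one (x : H ⊗[R] H) : actR R H 1 1 x = x := by
  induction x with
  | zero => simp
  | tmul h h' => simp
  | add x y hx hy => simp only [map_add, hx, hy]

theorem actB_add_left (a a' b : H) (x : BalTensor R H) :
    actB R H (a + a') b x = actB R H a b x + actB R H a' b x := by
  induction x using bal_induction with
  | zero => simp
  | tmul h h' => simp [add_mul, balTmul_add_left]
  | add x y hx hy => simp only [map_add, hx, hy]; abel

theorem actB_add_right (a b b' : H) (x : BalTensor R H) :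
    actB R H a (b + b') x = actB R H a b x + actB R H a b' x := by
  induction x using bal_induction with
  | zero => simp
  | tmul h h' => simp [mul_add, balTmul_add_right]
  | add x y hx hy => simp only [map_add, hx, hy]; abel

theorem actB_actB (a b c d : H) (x : BalTensor R H) :
    actB R H a b (actB R H c d x) = actB R H (a * c) (d * b) x := by
  induction x using bal_induction with
  | zero => simp
  | tmul h h' => simp [mul_assoc]
  | add x y hx hy => simp only [map_add, hx, hy]

theorem actB_one (x : BalTensor R H) : actB R H 1 1 x = x := by
  induction x using bal_induction with
  | zero => simp
  | tmul h h' => simp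
  | add x y hx hy => simp only [map_add, hx, hy]

end Basic

/-! ### Takeuchi products -/

section Takeuchi

variable (R H : Type*) [CommRing R] [Ring H] [Module R H] [IsScalarTower R H H]

/-- The Takeuchi product `H ×_R H`, as a subgroup of `H ⊗[R] H`: all `∑ hᵢ ⊗ hᵢ'` such that
`∑ hᵢ r ⊗ hᵢ' = ∑ hᵢ ⊗ hᵢ' r` for all `r` in `R`. -/
def takeuchi : AddSubgroup (H ⊗[R] H) where
  carrier := {x | ∀ r : R, actR R H (incl R H r) 1 x = actR R H 1 (incl R H r) x}
  zero_mem' r := by simp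
  add_mem' hx hy r := by rw [map_add, map_add, hx r, hy r]
  neg_mem' hx r := by rw [map_neg, map_neg, hx r]

/-- The Takeuchi product of `H` and its opposite, as a subgroup of the balanced tensor product:
all `∑ hᵢ ⊗ hᵢ'` such that `∑ r hᵢ ⊗ hᵢ' = ∑ hᵢ ⊗ hᵢ' r` for all `r` in `R`. -/
def balTakeuchi : AddSubgroup (BalTensor R H) where
  carrier := {x | ∀ r : R, actB R H (incl R H r) 1 x = actB R H 1 (incl R H r) x}
  zero_mem' r := by simp
  add_mem' hx hy r := by rw [map_add, map_add, hx r, hy r]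
  neg_mem' hx r := by rw [map_neg, map_neg, hx r]

variable {R H}

/-- Componentwise multiplication from the left, `(∑ hᵢ ⊗ hᵢ') (a ⊗ b) = ∑ hᵢ a ⊗ hᵢ' b`,
by an element of the Takeuchi product. -/
def takMul (x : H ⊗[R] H) (hx : x ∈ takeuchi R H) : H ⊗[R] H →+ H ⊗[R] H :=
  TensorProduct.liftAddHom
    (AddMonoidHom.mk' (fun a => AddMonoidHom.mk' (fun b => actR R H a b x)
        fun b b' => actR_add_right a b b' x)
      fun a a' => AddMonoidHom.ext fun b => actR_add_left a a' b x)
    fun r a b => by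
      change actR R H (r • a) b x = actR R H a (r • b) x
      have h1 := actR_actR a b (incl R H r) 1 x
      have h2 := actR_actR a b 1 (incl R H r) x
      rw [one_mul, incl_mul] at h1 h2
      rw [← h1, ← h2, hx r]

/-- Componentwise multiplication from the right,
`(a ⊗ b) (∑ hᵢ ⊗ hᵢ') = ∑ a hᵢ ⊗ hᵢ' b`, by an element of the Takeuchi product of `H` and its
opposite. -/
def balMul (y : BalTensor R H) (hy : y ∈ balTakeuchi R H) : BalTensor R H →+ BalTensor R H :=
  TensorProduct.liftAddHom
    (AddMonoidHom.mk' (fun a : RightCopy R H =>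
        AddMonoidHom.mk' (fun b : H => actB R H (ofRight a) b y)
          fun b b' => actB_add_right (ofRight a) b b' y)
      fun a a' => AddMonoidHom.ext fun b => actB_add_left (ofRight a) (ofRight a') b y)
    fun r a b => by
      change actB R H (ofRight a * incl R H r) b y = actB R H (ofRight a) (r • b) y
      have h1 := actB_actB (ofRight a) b (incl R H r) 1 y
      have h2 := actB_actB (ofRight a) b 1 (incl R H r) y
      rw [one_mul] at h1
      rw [mul_one, incl_mul] at h2
      rw [← h1, hy r, h2]

@[simp] theorem takMul_tmul (x : H ⊗[R] H) (hx : x ∈ takeuchi R H) (a b : H) :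
    takMul x hx (a ⊗ₜ[R] b) = actR R H a b x := rfl

@[simp] theorem balMul_balTmul (y : BalTensor R H) (hy : y ∈ balTakeuchi R H) (a b : H) :
    balMul y hy (balTmul R H a b) = actB R H a b y := rfl

theorem takMul_actR (x : H ⊗[R] H) (hx : x ∈ takeuchi R H) (a b : H) (y : H ⊗[R] H) :
    takMul x hx (actR R H a b y) = actR R H a b (takMul x hx y) := by
  induction y with
  | zero => simp
  | tmul h h' => simp [actR_actR]
  | add y z hy hz => simp only [map_add, hy, hz]

theorem balMul_actB (y : BalTensor R H) (hy : y ∈ balTakeuchi R H) (a b : H)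
    (x : BalTensor R H) :
    balMul y hy (actB R H a b x) = actB R H a b (balMul y hy x) := by
  induction x using bal_induction with
  | zero => simp
  | tmul h h' => simp [actB_actB]
  | add y z hy hz => simp only [map_add, hy, hz]

theorem tmul_one_mem (a : H) (ha : ∀ r : R, Commute (incl R H r) a) :
    a ⊗ₜ[R] (1 : H) ∈ takeuchi R H := by
  intro r
  simp only [actR_tmul, mul_one, one_mul]
  rw [← (ha r).eq, incl_mul, ← mul_one (incl R H r), incl_mul, TensorProduct.smul_tmul]

theorem balTmul_one_mem (a : H) (ha : ∀ r : R, Commute (incl R H r) a) :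
    balTmul R H a 1 ∈ balTakeuchi R H := by
  intro r
  simp only [actB_balTmul, mul_one, one_mul]
  rw [(ha r).eq, balTmul_balanced, ← incl_mul, mul_one]

instance : Mul (takeuchi R H) where
  mul x y := ⟨takMul x.1 x.2 y.1, fun r => by
    rw [← takMul_actR, ← takMul_actR, y.2 r]⟩

instance : Mul (balTakeuchi R H) where
  mul x y := ⟨balMul y.1 y.2 x.1, fun r => by
    rw [← balMul_actB, ← balMul_actB, x.2 r]⟩

instance : One (takeuchi R H) where
  one := ⟨1 ⊗ₜ[R] 1, tmul_one_mem 1 fun _ => Commute.one_right _⟩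

instance : One (balTakeuchi R H) where
  one := ⟨balTmul R H 1 1, balTmul_one_mem 1 fun _ => Commute.one_right _⟩

theorem takMul_add (x y z : H ⊗[R] H) (hx : x ∈ takeuchi R H) (hy : y ∈ takeuchi R H)
    (hxy : x + y ∈ takeuchi R H) : takMul (x + y) hxy z = takMul x hx z + takMul y hy z := by
  induction z with
  | zero => simp
  | tmul h h' => simp
  | add y z hy hz => simp only [map_add, hy, hz]; abel

theorem balMul_add (x y z : BalTensor R H) (hx : x ∈ balTakeuchi R H) (hy : y ∈ balTakeuchi R H)
    (hxy : x + y ∈ balTakeuchi R H) : balMul (x + y) hxy z = balMul x hx z + balMul y hy z := by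
  induction z using bal_induction with
  | zero => simp
  | tmul h h' => simp
  | add y z hy hz => simp only [map_add, hy, hz]; abel

theorem takMul_zero (z : H ⊗[R] H) (h0 : 0 ∈ takeuchi R H) : takMul 0 h0 z = 0 := by
  have h := takMul_add 0 0 z h0 h0 (by simp)
  simpa using h

theorem balMul_zero (z : BalTensor R H) (h0 : 0 ∈ balTakeuchi R H) : balMul 0 h0 z = 0 := by
  have h := balMul_add 0 0 z h0 h0 (by simp)
  simpa using h

theorem takMul_takMul (x y : takeuchi R H) (z : H ⊗[R] H) :
    takMul (x * y).1 (x * y).2 z = takMul x.1 x.2 (takMul y.1 y.2 z) := by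
  induction z with
  | zero => simp
  | tmul h h' => rw [takMul_tmul, takMul_tmul, takMul_actR]; rfl
  | add y z hy hz => simp only [map_add, hy, hz]

theorem balMul_balMul (x y : balTakeuchi R H) (z : BalTensor R H) :
    balMul (x * y).1 (x * y).2 z = balMul y.1 y.2 (balMul x.1 x.2 z) := by
  induction z using bal_induction with
  | zero => simp
  | tmul h h' => rw [balMul_balTmul, balMul_balTmul, balMul_actB]; rfl
  | add y z hy hz => simp only [map_add, hy, hz]

theorem takMul_one (z : H ⊗[R] H) : takMul (1 : takeuchi R H).1 (1 : takeuchi R H).2 z = z := by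
  induction z with
  | zero => simp
  | tmul h h' =>
    rw [takMul_tmul]
    change actR R H h h' (1 ⊗ₜ[R] 1) = _
    simp
  | add y z hy hz => simp only [map_add, hy, hz]

theorem balMul_one (z : BalTensor R H) :
    balMul (1 : balTakeuchi R H).1 (1 : balTakeuchi R H).2 z = z := by
  induction z using bal_induction with
  | zero => simp
  | tmul h h' =>
    rw [balMul_balTmul]
    change actB R H h h' (balTmul R H 1 1) = _
    simp
  | add y z hy hz => simp only [map_add, hy, hz]

/-- The ring structure on the Takeuchi product given by componentwise multiplication,
`(∑ᵢ hᵢ ⊗ hᵢ') (∑ⱼ gⱼ ⊗ gⱼ') = ∑ᵢⱼ hᵢ gⱼ ⊗ hᵢ' gⱼ'`. -/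
instance : Ring (takeuchi R H) where
  mul_assoc x y z := Subtype.ext (takMul_takMul x y z.1)
  one_mul x := Subtype.ext (takMul_one x.1)
  mul_one x := Subtype.ext (actR_one x.1)
  left_distrib x y z := Subtype.ext (map_add (takMul x.1 x.2) y.1 z.1)
  right_distrib x y z := Subtype.ext (takMul_add x.1 y.1 z.1 x.2 y.2 (x + y).2)
  zero_mul x := Subtype.ext (takMul_zero x.1 (0 : takeuchi R H).2)
  mul_zero x := Subtype.ext (map_zero (takMul x.1 x.2))
  zsmul := fun n x => n • x
  zsmul_zero' := SubNegMonoid.zsmul_zero'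
  zsmul_succ' := SubNegMonoid.zsmul_succ'
  zsmul_neg' := SubNegMonoid.zsmul_neg'
  neg_add_cancel := neg_add_cancel
  sub_eq_add_neg := sub_eq_add_neg

/-- The ring structure on the Takeuchi product of `H` and its opposite given by componentwise
multiplication, `(∑ᵢ hᵢ ⊗ hᵢ') (∑ⱼ gⱼ ⊗ gⱼ') = ∑ᵢⱼ hᵢ gⱼ ⊗ gⱼ' hᵢ'`. -/
instance : Ring (balTakeuchi R H) where
  mul_assoc x y z := Subtype.ext (balMul_balMul y z x.1).symm
  one_mul x := Subtype.ext (actB_one x.1)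
  mul_one x := Subtype.ext (balMul_one x.1)
  right_distrib x y z := Subtype.ext (map_add (balMul z.1 z.2) x.1 y.1)
  left_distrib x y z := Subtype.ext (balMul_add y.1 z.1 x.1 y.2 z.2 (y + z).2)
  mul_zero x := Subtype.ext (balMul_zero x.1 (0 : balTakeuchi R H).2)
  zero_mul x := Subtype.ext (map_zero (balMul x.1 x.2))
  zsmul := fun n x => n • x
  zsmul_zero' := SubNegMonoid.zsmul_zero'
  zsmul_succ' := SubNegMonoid.zsmul_succ'
  zsmul_neg' := SubNegMonoid.zsmul_neg'
  neg_add_cancel := neg_add_cancel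
  sub_eq_add_neg := sub_eq_add_neg

end Takeuchi

section TakeuchiAlgebra

variable {k R H : Type*} [Field k] [CommRing R] [Ring H] [Algebra k H] [Module R H]
  [IsScalarTower R H H]

theorem takMul_algebraMap (c : k) (hc : algebraMap k H c ⊗ₜ[R] (1 : H) ∈ takeuchi R H)
    (z : H ⊗[R] H) : takMul _ hc z = actR R H (algebraMap k H c) 1 z := by
  induction z with
  | zero => simp
  | tmul h h' => simp [Algebra.commutes c h]
  | add y z hy hz => simp only [map_add, hy, hz]

theorem balMul_algebraMap (c : k) (hc : balTmul R H (algebraMap k H c) 1 ∈ balTakeuchi R H)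
    (z : BalTensor R H) : balMul _ hc z = actB R H (algebraMap k H c) 1 z := by
  induction z using bal_induction with
  | zero => simp
  | tmul h h' => simp [Algebra.commutes c h]
  | add y z hy hz => simp only [map_add, hy, hz]

/-- The `k`-algebra structure of the Takeuchi product, in which a scalar `c` is `c ⊗ 1`. -/
instance : Algebra k (takeuchi R H) :=
  RingHom.toAlgebra'
    { toFun := fun c => ⟨algebraMap k H c ⊗ₜ[R] 1,
        tmul_one_mem _ fun _ => Algebra.commute_algebraMap_right c _⟩
      map_one' := Subtype.ext (congrArg (· ⊗ₜ[R] (1 : H)) (map_one (algebraMap k H)))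
      map_zero' := Subtype.ext (by simp)
      map_mul' := fun c d => Subtype.ext (by
        refine Eq.trans ?_ (takMul_algebraMap (R := R) c _ (algebraMap k H d ⊗ₜ[R] 1)).symm
        rw [actR_tmul, mul_one, ← map_mul, mul_comm])
      map_add' := fun c d => Subtype.ext (by simp [TensorProduct.add_tmul]) }
    fun c x => Subtype.ext (takMul_algebraMap c _ x.1)

/-- The `k`-algebra structure of the Takeuchi product of `H` and its opposite, in which a scalar
`c` is `c ⊗ 1`. -/
instance : Algebra k (balTakeuchi R H) :=
  RingHom.toAlgebra'
    { toFun := fun c => ⟨balTmul R H (algebraMap k H c) 1,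
        balTmul_one_mem _ fun _ => Algebra.commute_algebraMap_right c _⟩
      map_one' := Subtype.ext (congrArg (balTmul R H · 1) (map_one (algebraMap k H)))
      map_zero' := Subtype.ext (by
        simp only [map_zero]
        exact TensorProduct.zero_tmul _ _)
      map_mul' := fun c d => Subtype.ext (by
        refine Eq.trans ?_ (balMul_algebraMap (R := R) d _ (balTmul R H (algebraMap k H c) 1)).symm
        rw [actB_balTmul, mul_one, ← map_mul, mul_comm])
      map_add' := fun c d => Subtype.ext (by simp [balTmul_add_left]) }
    fun c x => Subtype.ext (balMul_algebraMap c _ x.1).symm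

end TakeuchiAlgebra

/-! ### Bialgebroids and Hopf algebroids -/

section Hopf

open Coalgebra

variable (k R H : Type*) [Field k] [CommRing R] [Algebra k R] [Ring H] [Algebra k H] [Module R H]
  [IsScalarTower R H H] [IsScalarTower k R H]

/-- The left `R`-module coalgebra `H` is a left bialgebroid over `R`: the map `R → H` is an
embedding, the comultiplication is a `k`-algebra morphism into the Takeuchi product, and
`h ↦ (r ↦ ε (h r))` is a representation of `H` on `R` extending the regular one. -/
structure IsLeftBialgebroid [Coalgebra R H] : Prop where
  incl_injective : Function.Injective (incl R H)
  comul_algHom : ∃ Δ : H →ₐ[k] takeuchi R H, ∀ h, (Δ h : H ⊗[R] H) = comul (R := R) h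
  counit_rep : ∃ ρ : H →ₐ[k] Module.End k R,
    (∀ h r, ρ h r = counit (R := R) (h * incl R H r)) ∧ ∀ r r' : R, ρ (incl R H r) r' = r * r'

variable {k R H}

theorem IsLeftBialgebroid.comul_mul_incl [Coalgebra R H] (hB : IsLeftBialgebroid k R H)
    (h : H) (r : R) :
    comul (R := R) (h * incl R H r) = actR R H 1 (incl R H r) (comul (R := R) h) := by
  obtain ⟨Δ, hΔ⟩ := hB.comul_algHom
  have hr : (Δ (incl R H r) : H ⊗[R] H) = incl R H r ⊗ₜ[R] 1 := by
    have h1 : comul (R := R) (1 : H) = 1 ⊗ₜ[R] 1 := by rw [← hΔ, map_one]; rfl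
    rw [hΔ]
    change comul (R := R) (r • (1 : H)) = (r • (1 : H)) ⊗ₜ[R] 1
    rw [map_smul, h1, TensorProduct.smul_tmul']
  rw [← hΔ, ← hΔ h, map_mul]
  change takMul (Δ h).1 (Δ h).2 (Δ (incl R H r)).1 = _
  rw [hr, takMul_tmul]
  exact (Δ h).2 r

/-- The Galois map `h ⊗ h' ↦ ∑ h₍₁₎ ⊗ h₍₂₎ h'` from the balanced tensor product to the tensor
product of left modules, where `∑ h₍₁₎ ⊗ h₍₂₎` is the comultiplication of `h`. -/
def galois [Coalgebra R H] (hB : IsLeftBialgebroid k R H) : BalTensor R H →+ H ⊗[R] H :=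
  TensorProduct.liftAddHom
    (AddMonoidHom.mk' (fun h : RightCopy R H =>
        AddMonoidHom.mk' (fun h' : H => actR R H 1 h' (comul (R := R) (ofRight h)))
          fun b b' => actR_add_right 1 b b' _)
      fun a a' => AddMonoidHom.ext fun b => by
        change actR R H 1 b (comul (R := R) (ofRight a + ofRight a')) =
          actR R H 1 b (comul (R := R) (ofRight a)) + actR R H 1 b (comul (R := R) (ofRight a'))
        rw [map_add, map_add])
    fun r a b => by
      change actR R H 1 b (comul (R := R) (ofRight a * incl R H r)) =
        actR R H 1 (r • b) (comul (R := R) (ofRight a))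
      rw [hB.comul_mul_incl, actR_actR, one_mul, incl_mul]

theorem galois_balTmul [Coalgebra R H] (hB : IsLeftBialgebroid k R H) (h h' : H) :
    galois hB (balTmul R H h h') = actR R H 1 h' (comul (R := R) h) := rfl

variable (k R H) in
/-- A Hopf algebroid is a left bialgebroid whose Galois map is bijective. -/
structure IsHopfAlgebroid [Coalgebra R H] : Prop extends IsLeftBialgebroid k R H where
  galois_bijective : Function.Bijective (galois toIsLeftBialgebroid)

/-- The translation map `h ↦ Gal⁻¹ (h ⊗ 1)` of a Hopf algebroid. -/
def IsHopfAlgebroid.red [Coalgebra R H] (hH : IsHopfAlgebroid k R H) (h : H) : BalTensor R H :=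
  (Equiv.ofBijective _ hH.galois_bijective).symm (h ⊗ₜ[R] 1)

variable {A : Type*} [Ring A] [Algebra k A] [Module R A] [IsScalarTower R A A]
  [IsScalarTower k R A]

/-- An `R`-linear algebra morphism, seen as an `R`-linear map. -/
def linearOf (j : A →ₐ[k] H) (hj : ∀ (r : R) (a : A), j (r • a) = r • j a) : A →ₗ[R] H where
  toFun := j
  map_add' := map_add j
  map_smul' := hj

/-- The embedding `j` exhibits the Hopf algebroid `A` over `R` as a Hopf subalgebroid of `H`: it is
`R`-linear and compatible with comultiplication and counit. -/
structure IsHopfSubalgebroid [Coalgebra R A] [Coalgebra R H] (j : A →ₐ[k] H) : Prop where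
  isHopfAlgebroid : IsHopfAlgebroid k R A
  injective : Function.Injective j
  map_smul : ∀ (r : R) (a : A), j (r • a) = r • j a
  map_comul : ∀ a : A, comul (R := R) (j a) =
    TensorProduct.map (linearOf j map_smul) (linearOf j map_smul) (comul (R := R) a)
  map_counit : ∀ a : A, counit (R := R) (j a) = counit (R := R) a

end Hopf

/-! ### The twisted group algebra -/

section TwistedGroupAlgebra

open Coalgebra

variable (R G : Type*) [CommRing R]

/-- The `R`-linear map out of the twisted group algebra with prescribed values on group elements. -/
def twistedLift {P : Type*} [AddCommGroup P] [Module R P] (v : G → P) :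
    SkewMonoidAlgebra R G →ₗ[R] P where
  toFun f := Finsupp.linearCombination R v f.coeff
  map_add' f g := by rw [SkewMonoidAlgebra.coeff_add, map_add]
  map_smul' r f := by rw [SkewMonoidAlgebra.coeff_smul, map_smul]; rfl

variable {R G} in
@[simp] theorem twistedLift_single {P : Type*} [AddCommGroup P] [Module R P] (v : G → P) (g : G)
    (r : R) : twistedLift R G v (SkewMonoidAlgebra.single g r) = r • v g := by
  simp [twistedLift]

/-- The coalgebra structure on the twisted group algebra with `Δ (r g) = r g ⊗ g` and
`ε (r g) = r`. -/
instance : Coalgebra R (SkewMonoidAlgebra R G) where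
  comul := twistedLift R G fun g =>
    SkewMonoidAlgebra.single g (1 : R) ⊗ₜ[R] SkewMonoidAlgebra.single g (1 : R)
  counit := twistedLift R G fun _ => 1
  coassoc := SkewMonoidAlgebra.lhom_ext fun g r => by simp
  rTensor_counit_comp_comul := SkewMonoidAlgebra.lhom_ext fun g r => by
    simp [← TensorProduct.tmul_smul, SkewMonoidAlgebra.smul_single]
  lTensor_counit_comp_comul := SkewMonoidAlgebra.lhom_ext fun g r => by
    simp [TensorProduct.smul_tmul', SkewMonoidAlgebra.smul_single]

end TwistedGroupAlgebra

end HopfAlgebroid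

end

/-! ### The geometric representation and the nil Hecke algebra -/

noncomputable section

namespace CoxeterSystem

section Geometric

variable {B : Type*} (M : CoxeterMatrix B)

/-- The simple root `α_s`, a basis vector of the real vector space `B →₀ ℝ`. -/
def simpleRoot (s : B) : B →₀ ℝ := Finsupp.single s 1

/-- The symmetric bilinear form with `(α_s, α_t) = - cos (π / m_{st})`. For `m_{st} = ∞`, encoded
by `M s t = 0`, the value is `-1`. -/
def form : (B →₀ ℝ) →ₗ[ℝ] (B →₀ ℝ) →ₗ[ℝ] ℝ :=
  Finsupp.linearCombination ℝ fun s => Finsupp.linearCombination ℝ fun t =>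
    -Real.cos (Real.pi / (M s t : ℝ))

/-- The linear form `⟨x, α_s^∨⟩ = 2 (x, α_s) / (α_s, α_s)`. -/
def coroot (s : B) : Module.Dual ℝ (B →₀ ℝ) :=
  (2 / form M (simpleRoot s) (simpleRoot s)) • (form M).flip (simpleRoot s)

/-- The reflection `x ↦ x - ⟨x, α_s^∨⟩ α_s`. -/
def geomReflection (s : B) : Module.End ℝ (B →₀ ℝ) :=
  LinearMap.id - (coroot M s).smulRight (simpleRoot s)

theorem form_simpleRoot (s t : B) :
    form M (simpleRoot s) (simpleRoot t) = -Real.cos (Real.pi / (M s t : ℝ)) := by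
  simp [form, simpleRoot]

theorem coroot_simpleRoot (s t : B) :
    coroot M s (simpleRoot t) = -2 * Real.cos (Real.pi / (M s t : ℝ)) := by
  simp [coroot, form_simpleRoot, M.symmetric t s]

theorem coroot_self (s : B) : coroot M s (simpleRoot s) = 2 := by
  simp [coroot_simpleRoot]

theorem geomReflection_eq (s : B) :
    geomReflection M s = (Module.reflection (coroot_self M s)).toLinearMap := by
  refine LinearMap.ext fun x => ?_
  simp [geomReflection, Module.reflection_apply]

open Polynomial.Chebyshev in
theorem reflection_pow_eq_one {V : Type*} [AddCommGroup V] [Module ℝ V] {x y : V}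
    {f g : Module.Dual ℝ V} (hf : f x = 2) (hg : g y = 2) (m : ℕ) (hm : 2 ≤ m)
    (hfy : f y = -2 * Real.cos (Real.pi / m)) (hgx : g x = -2 * Real.cos (Real.pi / m)) :
    (Module.reflection hf * Module.reflection hg) ^ m = 1 := by
  ext z : 1
  rcases hm.eq_or_lt with rfl | hm3
  · have h1 : f y = 0 := by rw [hfy]; simp
    have h2 : g x = 0 := by rw [hgx]; simp
    simp only [pow_two, LinearEquiv.mul_apply, Module.reflection_apply, map_sub, map_smul, hf, hg,
      h1, h2, LinearEquiv.coe_one, id_eq]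
    module
  have hm0 : (0 : ℝ) < m := by positivity
  have hm3' : (3 : ℝ) ≤ m := by exact_mod_cast hm3
  set θ : ℝ := 2 * (Real.pi / m) with hθ
  have hθm : m * θ = 2 * Real.pi := by rw [hθ]; field_simp
  have hsin : Real.sin θ ≠ 0 := by
    refine (Real.sin_pos_of_pos_of_lt_pi (by positivity) ?_).ne'
    nlinarith [Real.pi_pos]
  have ht : 2 * Real.cos θ = f y * g x - 2 := by
    rw [hfy, hgx, hθ, Real.cos_two_mul]; ring
  rw [Module.reflection_mul_reflection_pow_apply hf hg m z (2 * Real.cos θ) ht]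
  have hS (n : ℤ) : (S ℝ n).eval (2 * Real.cos θ) = Real.sin ((n + 1) * θ) / Real.sin θ := by
    rw [eq_div_iff hsin, S_two_mul_real_cos]
  rcases Nat.even_or_odd' m with ⟨k, rfl | rfl⟩
  · have e1 : (((2 * k : ℕ) : ℤ) - 2) / 2 = (k : ℤ) - 1 := by omega
    have e2 : (((2 * k : ℕ) : ℤ) - 1) / 2 = (k : ℤ) - 1 := by omega
    have hk : (S ℝ ((k : ℤ) - 1)).eval (2 * Real.cos θ) = 0 := by
      rw [hS]
      push_cast at hθm ⊢
      rw [show ((k : ℝ) - 1 + 1) * θ = Real.pi by linarith]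
      simp
    rw [e1, e2, hk]
    simp
  · have e1 : (((2 * k + 1 : ℕ) : ℤ) - 1) / 2 = (k : ℤ) := by omega
    have e2 : (((2 * k + 1 : ℕ) : ℤ) - 3) / 2 = (k : ℤ) - 1 := by omega
    have e3 : ((2 * k + 1 : ℕ) : ℤ) / 2 = (k : ℤ) := by omega
    have e4 : (((2 * k + 1 : ℕ) : ℤ) - 2) / 2 = (k : ℤ) - 1 := by omega
    have hk : (S ℝ (k : ℤ)).eval (2 * Real.cos θ) +
        (S ℝ ((k : ℤ) - 1)).eval (2 * Real.cos θ) = 0 := by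
      rw [hS, hS, ← add_div]
      push_cast at hθm ⊢
      rw [show ((k : ℝ) - 1 + 1) * θ = 2 * Real.pi - ((k : ℝ) + 1) * θ by linarith,
        Real.sin_two_pi_sub]
      simp
    rw [e1, e2, e3, e4, hk]
    simp

theorem geomReflection_isLiftable : M.IsLiftable (geomReflection M) := by
  intro s t
  have key : (Module.reflection (coroot_self M s) * Module.reflection (coroot_self M t)) ^ M s t
      = 1 := by
    by_cases hst : s = t
    · subst hst
      rw [M.diagonal, pow_one]
      exact LinearEquiv.ext fun x => Module.involutive_reflection (coroot_self M s) x
    rcases Nat.eq_zero_or_pos (M s t) with h0 | hpos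
    · rw [h0, pow_zero]
    have hm1 : M s t ≠ 1 := M.off_diagonal s t hst
    exact reflection_pow_eq_one _ _ _ (by omega) (coroot_simpleRoot M s t)
      (by rw [coroot_simpleRoot, M.symmetric t s])
  rw [geomReflection_eq, geomReflection_eq]
  have h := congrArg (LinearEquiv.automorphismGroup.toLinearMapMonoidHom (R := ℝ)) key
  rwa [map_pow, map_mul, map_one] at h

end Geometric

variable {B W : Type*} [Group W] {M : CoxeterMatrix B} (cs : CoxeterSystem M W)

/-- The geometric representation of `W`, in which a simple reflection `s` acts by
`x ↦ x - ⟨x, α_s^∨⟩ α_s`. -/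
def geomRep : W →* Module.End ℝ (B →₀ ℝ) := cs.lift ⟨geomReflection M, geomReflection_isLiftable M⟩

/-- The symmetric algebra `R` of the geometric representation. -/

def SymRing (_cs : CoxeterSystem M W) : Type _ := SymmetricAlgebra ℝ (B →₀ ℝ)

instance : CommRing (SymRing cs) := inferInstanceAs (CommRing (SymmetricAlgebra ℝ (B →₀ ℝ)))

instance : Algebra ℝ (SymRing cs) := inferInstanceAs (Algebra ℝ (SymmetricAlgebra ℝ (B →₀ ℝ)))

/-- A vector of the geometric representation as an element of its symmetric algebra. -/
def symι : (B →₀ ℝ) →ₗ[ℝ] SymRing cs := SymmetricAlgebra.ι ℝ (B →₀ ℝ)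

/-- The action of a group element on `R` by the algebra endomorphism which extends the geometric
representation. -/
def symAct (w : W) : SymRing cs →ₐ[ℝ] SymRing cs :=
  SymmetricAlgebra.lift (A := SymRing cs) (symι cs ∘ₗ geomRep cs w)

theorem symAct_ι (w : W) (x : B →₀ ℝ) : symAct cs w (symι cs x) = symι cs (geomRep cs w x) :=
  SymmetricAlgebra.lift_ι_apply (A := SymRing cs) _ _

theorem sym_hom_ext {A : Type*} [CommRing A] [Algebra ℝ A] {F G : SymRing cs →ₐ[ℝ] A}
    (h : ∀ x, F (symι cs x) = G (symι cs x)) : F = G :=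
  SymmetricAlgebra.algHom_ext (LinearMap.ext h)

instance : MulSemiringAction W (SymRing cs) where
  smul w f := symAct cs w f
  one_smul f := by
    have h : symAct cs 1 = AlgHom.id ℝ _ := sym_hom_ext cs fun x => by
      rw [symAct_ι, map_one]; rfl
    exact DFunLike.congr_fun h f
  mul_smul w w' f := by
    have h : symAct cs (w * w') = (symAct cs w).comp (symAct cs w') := sym_hom_ext cs fun x => by
      rw [AlgHom.comp_apply, symAct_ι, symAct_ι, symAct_ι, map_mul]; rfl
    exact DFunLike.congr_fun h f
  smul_zero w := map_zero (symAct cs w)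
  smul_add w := map_add (symAct cs w)
  smul_one w := map_one (symAct cs w)
  smul_mul w := map_mul (symAct cs w)

instance : SMulCommClass W ℝ (SymRing cs) where
  smul_comm w c f := map_smul (symAct cs w) c f

/-- The alternating product `a b a ⋯` with `n` factors. -/
def altProd {A : Type*} [Monoid A] (a b : A) : ℕ → A
  | 0 => 1
  | n + 1 => a * altProd b a n

/-- The free algebra on the vectors `x` of the geometric representation and the symbols `∂_s`. -/
abbrev FreeNilHecke (B : Type*) : Type _ := FreeAlgebra ℝ ((B →₀ ℝ) ⊕ B)

/-- The generator of the free algebra given by a vector. -/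
abbrev freeWt (x : B →₀ ℝ) : FreeNilHecke B := FreeAlgebra.ι ℝ (Sum.inl x)

/-- The generator `∂_s` of the free algebra. -/
abbrev freeDel (s : B) : FreeNilHecke B := FreeAlgebra.ι ℝ (Sum.inr s)

/-- The defining relations of the nil Hecke algebra. The first two say that the vectors form a
linear subspace. In the last one, `M s t = 0` encodes `m_{st} = ∞` and gives no condition. -/
inductive NilHeckeRel (M : CoxeterMatrix B) : FreeNilHecke B → FreeNilHecke B → Prop
  | add (x y : B →₀ ℝ) : NilHeckeRel M (freeWt (x + y)) (freeWt x + freeWt y)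
  | smul (c : ℝ) (x : B →₀ ℝ) : NilHeckeRel M (freeWt (c • x)) (c • freeWt x)
  | comm (x y : B →₀ ℝ) : NilHeckeRel M (freeWt x * freeWt y) (freeWt y * freeWt x)
  | twistedWeyl (s : B) (x : B →₀ ℝ) : NilHeckeRel M (freeDel s * freeWt x)
      (freeWt (geomReflection M s x) * freeDel s + algebraMap ℝ _ (coroot M s x))
  | nil (s : B) : NilHeckeRel M (freeDel s * freeDel s) 0
  | braid (s t : B) : NilHeckeRel M (altProd (freeDel s) (freeDel t) (M s t))
      (altProd (freeDel t) (freeDel s) (M s t))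

/-- The affine nil Hecke algebra of a Coxeter system. -/
def NilHecke (_cs : CoxeterSystem M W) : Type _ := RingQuot (NilHeckeRel M)

instance : Ring (NilHecke cs) := inferInstanceAs (Ring (RingQuot (NilHeckeRel M)))

instance : Algebra ℝ (NilHecke cs) := inferInstanceAs (Algebra ℝ (RingQuot (NilHeckeRel M)))

/-- The projection from the free algebra. -/
def nhMk : FreeNilHecke B →ₐ[ℝ] NilHecke cs := RingQuot.mkAlgHom ℝ (NilHeckeRel M)

theorem nhMk_rel {a b : FreeNilHecke B} (h : NilHeckeRel M a b) : nhMk cs a = nhMk cs b :=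
  RingQuot.mkAlgHom_rel ℝ h

/-- A vector of the geometric representation as an element of the nil Hecke algebra. -/
def wt : (B →₀ ℝ) →ₗ[ℝ] NilHecke cs where
  toFun x := nhMk cs (freeWt x)
  map_add' x y := by rw [nhMk_rel cs (.add x y), map_add]
  map_smul' c x := by rw [nhMk_rel cs (.smul c x), map_smul]; rfl

/-- The nil Coxeter generator `∂_s`. -/
def del (s : B) : NilHecke cs := nhMk cs (freeDel s)

theorem wt_comm (x y : B →₀ ℝ) : wt cs x * wt cs y = wt cs y * wt cs x := by
  have h := nhMk_rel cs (.comm x y)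
  rwa [map_mul, map_mul] at h

/-- The commutative subalgebra of the nil Hecke algebra generated by the vectors. -/
abbrev wtAlg : Subalgebra ℝ (NilHecke cs) := Algebra.adjoin ℝ (Set.range (wt cs))

instance : CommRing (wtAlg cs) where
  mul_comm := (Algebra.isMulCommutative_adjoin ℝ (by
    rintro _ ⟨x, rfl⟩ _ ⟨y, rfl⟩
    exact wt_comm cs x y) : IsMulCommutative (wtAlg cs)).is_comm.comm

/-- The inclusion of vectors into the subalgebra which they generate. -/
def wtToAlg : (B →₀ ℝ) →ₗ[ℝ] wtAlg cs where
  toFun x := ⟨wt cs x, Algebra.subset_adjoin ⟨x, rfl⟩⟩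
  map_add' x y := Subtype.ext (map_add (wt cs) x y)
  map_smul' c x := Subtype.ext (map_smul (wt cs) c x)

/-- The algebra morphism from `R` to the nil Hecke algebra which extends the inclusion of
vectors. -/
def symIncl : SymRing cs →ₐ[ℝ] NilHecke cs :=
  (wtAlg cs).val.comp (SymmetricAlgebra.lift (wtToAlg cs))

theorem symIncl_ι (x : B →₀ ℝ) : symIncl cs (symι cs x) = wt cs x :=
  congrArg Subtype.val (SymmetricAlgebra.lift_ι_apply (wtToAlg cs) x)

/-- `R` acts on the nil Hecke algebra by multiplication from the left. -/
instance : Module (SymRing cs) (NilHecke cs) :=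
  Module.compHom (NilHecke cs) (symIncl cs).toRingHom

theorem sym_smul_def (r : SymRing cs) (h : NilHecke cs) : r • h = symIncl cs r * h := rfl

instance : IsScalarTower (SymRing cs) (NilHecke cs) (NilHecke cs) where
  smul_assoc r h h' := mul_assoc (symIncl cs r) h h'

instance : IsScalarTower ℝ (SymRing cs) (NilHecke cs) where
  smul_assoc c r h := by
    rw [sym_smul_def, sym_smul_def, map_smul, smul_mul_assoc]

/-- The element `s = 1 - α_s ∂_s` of the nil Hecke algebra. -/
def reflElt (s : B) : NilHecke cs := 1 - wt cs (simpleRoot s) * del cs s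

end CoxeterSystem

end

open HopfAlgebroid CoxeterSystem

open scoped TensorProduct

noncomputable section

/-! The braid relation is the heart of the matter: for every morphism out of NH the other defining
relations are short computations. Two arguments handle it.

The first works for operators `d s` that satisfy the remaining relations. Moving a vector λ past an
alternating product of the `d s`, `d t` gives w(λ) times the product plus two shorter terms, one
with the first and one with the last factor deleted; inner deletions leave a square and vanish. At
length m = m_{st} the shorter terms on the two sides of the braid relation agree, because the
dihedral word of length m - 1 sends a simple root to a simple root. So the difference Z of the two
sides satisfies Zλ = w₀(λ)Z (`altProd_sub_mul_wt`), and Z = 0 as soon as Z kills R-module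
generators. This gives the representation `polyRep` on R by Demazure operators and the
representation `nilRep` on the free R-module with basis W.

The second works inside NH and NH ⊗ NH. The same commutation formula shows that the longest
alternating word in ∂_s, ∂_t acts on R by a nonzero operator (`altProd_ne_zero`). Multiplying a
relation by complementary words then shows that the alternating words are R-linearly independent
already as operators on R (`linearIndependent_altWord`). Hence `polyRep` is faithful on their
R-span, and pairs of evaluations at f and g detect zero on the span of their tensors
(`eq_zero_of_tensorEval`). The relation (st)^m = 1 for s = 1 - α_s ∂_s, and the braid relation for
Δ(∂_s), thereby become identities on R: s acts as the reflection, and Δ(∂_s) encodes the twisted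
Leibniz rule of the Demazure operator (`tensorEval_delTakMul`).

The coalgebra axioms and cocommutativity follow by induction over left multiplication by generators.
They use the two forms of Δ(∂_s), which the flip exchanges, and the fact that s is group-like. The
translation map is (τ ⊠ 1) ∘ Δ ∘ τ, where τ is the anti-automorphism fixing the generators, so its
multiplicativity needs no further relation check; that it inverts the Galois map comes down to s² =
1 and ∂_s s = -∂_s.

Injectivity of R ⋆ W → NH is read off from `nilRep`: applied to e_1, the element w yields a nonzero
multiple of e_w plus terms at shorter elements (`nilRep_groupElt`). Faithfulness of the geometric
representation is not needed. -/

namespace HopfAlgebroid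

/-! ### Inverting the Galois map by a candidate translation map -/

section Translation

open Coalgebra

variable {R H : Type*} [CommRing R] [Ring H] [Module R H] [IsScalarTower R H H]

/-- The map `h ⊗ h' ↦ red h (1 ⊗ h')` given by a candidate `red` for the translation map. -/
def translationLift (red : H →+ BalTensor R H) (hmem : ∀ h, red h ∈ balTakeuchi R H)
    (hsmul : ∀ (r : R) h, red (r • h) = actB R H (incl R H r) 1 (red h)) :
    H ⊗[R] H →+ BalTensor R H :=
  TensorProduct.liftAddHom
    (AddMonoidHom.mk' (fun h : H =>
        AddMonoidHom.mk' (fun h' : H => actB R H 1 h' (red h))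
          fun b b' => actB_add_right 1 b b' _)
      fun a a' => AddMonoidHom.ext fun b => by
        change actB R H 1 b (red (a + a')) = actB R H 1 b (red a) + actB R H 1 b (red a')
        rw [map_add, map_add])
    fun r a b => by
      change actB R H 1 b (red (r • a)) = actB R H 1 (r • b) (red a)
      -- The Takeuchi condition moves r from the left of the first factor to the right of the
      -- second, where it is absorbed into b.
      rw [hsmul, hmem a r, actB_actB, one_mul, incl_mul]

variable (red : H →+ BalTensor R H) (hmem : ∀ h, red h ∈ balTakeuchi R H)
    (hsmul : ∀ (r : R) h, red (r • h) = actB R H (incl R H r) 1 (red h))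

theorem translationLift_tmul (a b : H) :
    translationLift red hmem hsmul (a ⊗ₜ[R] b) = actB R H 1 b (red a) := rfl

theorem translationLift_actR (b : H) (y : H ⊗[R] H) :
    translationLift red hmem hsmul (actR R H 1 b y) =
      actB R H 1 b (translationLift red hmem hsmul y) := by
  induction y with
  | zero => simp
  | tmul h h' =>
    rw [actR_tmul, translationLift_tmul, translationLift_tmul, actB_actB, mul_one, mul_one]
  | add x y hx hy => simp only [map_add, hx, hy]

variable {k : Type*} [Field k] [Algebra k R] [Algebra k H] [IsScalarTower k R H] [Coalgebra R H]

theorem galois_actB (hB : IsLeftBialgebroid k R H) (b : H) (x : BalTensor R H) :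
    galois hB (actB R H 1 b x) = actR R H 1 b (galois hB x) := by
  induction x using bal_induction with
  | zero => simp
  | tmul h h' => rw [actB_balTmul, galois_balTmul, galois_balTmul, actR_actR, one_mul, one_mul]
  | add x y hx hy => simp only [map_add, hx, hy]

/-- The Galois map is bijective as soon as there is a candidate for the translation map which is
compatible with the Galois map and with the comultiplication. -/
theorem galois_bijective_of_translation (hB : IsLeftBialgebroid k R H)
    (h₁ : ∀ h, galois hB (red h) = h ⊗ₜ[R] 1)
    (h₂ : ∀ h, translationLift red hmem hsmul (comul (R := R) h) = balTmul R H h 1) :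
    Function.Bijective (galois hB) := by
  -- Both maps commute with right multiplication on the second factor, so the two composites need to
  -- be known only on elements h ⊠ 1 and h ⊗ 1, which are the two hypotheses.
  refine Function.bijective_iff_has_inverse.2 ⟨translationLift red hmem hsmul, fun x => ?_,
    fun y => ?_⟩
  · induction x using bal_induction with
    | zero => simp
    | tmul h h' =>
      rw [galois_balTmul, translationLift_actR, h₂, actB_balTmul, one_mul, one_mul]
    | add x y hx hy => simp only [map_add, hx, hy]
  · induction y with
    | zero => simp
    | tmul h h' =>
      rw [translationLift_tmul, galois_actB, h₁, actR_tmul, mul_one, one_mul]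
    | add x y hx hy => simp only [map_add, hx, hy]

theorem IsHopfAlgebroid.red_eq_of_galois_eq (hH : IsHopfAlgebroid k R H) {h : H}
    {x : BalTensor R H} (hx : galois hH.toIsLeftBialgebroid x = h ⊗ₜ[R] 1) : hH.red h = x := by
  rw [IsHopfAlgebroid.red, Equiv.symm_apply_eq]
  exact hx.symm

end Translation

/-! ### The twisted group algebra as a Hopf algebroid -/

section TwistedGroupAlgebra

open Coalgebra SkewMonoidAlgebra

variable {R G : Type*} [CommRing R]

theorem comul_single (g : G) (r : R) :
    comul (R := R) (single g r : SkewMonoidAlgebra R G) = single g r ⊗ₜ[R] single g 1 := by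
  change twistedLift R G _ (single g r) = _
  rw [twistedLift_single, TensorProduct.smul_tmul', SkewMonoidAlgebra.smul_single, smul_eq_mul,
    mul_one]

theorem counit_single (g : G) (r : R) :
    counit (R := R) (single g r : SkewMonoidAlgebra R G) = r := by
  change twistedLift R G _ (single g r) = _
  rw [twistedLift_single, smul_eq_mul, mul_one]

theorem tmul_single_smul (g : G) (r r' : R) (h : SkewMonoidAlgebra R G) :
    (single g (r * r') : SkewMonoidAlgebra R G) ⊗ₜ[R] h = single g r' ⊗ₜ[R] (r • h) := by
  rw [← TensorProduct.smul_tmul, SkewMonoidAlgebra.smul_single, smul_eq_mul]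

variable {k : Type*} [Field k] [Algebra k R] [Group G] [MulSemiringAction G R]
  [SMulCommClass G k R]

theorem incl_twisted (r : R) : incl R (SkewMonoidAlgebra R G) r = single 1 r := by
  change r • (1 : SkewMonoidAlgebra R G) = _
  rw [one_def, SkewMonoidAlgebra.smul_single, smul_eq_mul, mul_one]

theorem twisted_comul_mem (h : SkewMonoidAlgebra R G) :
    comul (R := R) h ∈ takeuchi R (SkewMonoidAlgebra R G) := by
  induction h using SkewMonoidAlgebra.induction_on with
  | zero => rw [map_zero]; exact zero_mem _
  | single g a =>
    intro r
    rw [comul_single, actR_tmul, actR_tmul, incl_twisted, single_mul_single, mul_one, mul_one,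
      single_mul_single, mul_comm a, tmul_single_smul, SkewMonoidAlgebra.smul_single]
    simp
  | add x y hx hy => rw [map_add]; exact add_mem hx hy

/-- The comultiplication of the twisted group algebra as an algebra morphism to the Takeuchi
product. -/
def twistedComul : SkewMonoidAlgebra R G →ₐ[k] takeuchi R (SkewMonoidAlgebra R G) where
  toFun h := ⟨comul (R := R) h, twisted_comul_mem h⟩
  map_zero' := Subtype.ext (map_zero _)
  map_add' x y := Subtype.ext (map_add _ x y)
  map_one' := Subtype.ext (comul_single 1 1)
  map_mul' x y := Subtype.ext (by
    change comul (R := R) (x * y) = takMul (comul (R := R) x) (twisted_comul_mem x)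
      (comul (R := R) y)
    induction y using SkewMonoidAlgebra.induction_on with
    | zero => simp
    | add y y' hy hy' => rw [mul_add, map_add, map_add, map_add, hy, hy']
    | single g a =>
      rw [comul_single, takMul_tmul]
      induction x using SkewMonoidAlgebra.induction_on with
      | zero => simp
      | add x x' hx hx' => rw [add_mul, map_add, map_add, map_add, hx, hx']
      | single g' a' => simp [comul_single, single_mul_single])
  commutes' c := Subtype.ext (by
    change comul (R := R) (algebraMap k _ c) = algebraMap k (SkewMonoidAlgebra R G) c ⊗ₜ[R] 1
    rw [coe_algebraMap]
    exact comul_single 1 _)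

/-- The representation of the twisted group algebra on `R`. -/
def twistedRep : SkewMonoidAlgebra R G →ₐ[k] Module.End k R :=
  liftNCAlgHom (Algebra.lmul k R) (DistribMulAction.toModuleEnd k R) fun {x y} => by
    refine LinearMap.ext fun f => ?_
    simp [smul_mul']

theorem twistedRep_single (g : G) (r f : R) :
    twistedRep (k := k) (single g r : SkewMonoidAlgebra R G) f = r * g • f := by
  simp [twistedRep, liftNCAlgHom, liftNCRingHom]

theorem twisted_isLeftBialgebroid : IsLeftBialgebroid k R (SkewMonoidAlgebra R G) where
  incl_injective r r' h := by
    rw [incl_twisted, incl_twisted] at h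
    exact single_injective 1 h
  comul_algHom := ⟨twistedComul, fun _ => rfl⟩
  counit_rep := by
    refine ⟨twistedRep, fun h r => ?_, fun r r' => ?_⟩
    · induction h using SkewMonoidAlgebra.induction_on with
      | zero => simp
      | add x x' hx hx' => rw [map_add, LinearMap.add_apply, add_mul, map_add, hx, hx']
      | single g a =>
        rw [incl_twisted, single_mul_single, counit_single, twistedRep_single]
    · rw [incl_twisted, twistedRep_single, one_smul]

/-- The translation map `r g ↦ r g ⊗ g⁻¹` of the twisted group algebra. -/
def twistedRed : SkewMonoidAlgebra R G →+ BalTensor R (SkewMonoidAlgebra R G) :=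
  (Finsupp.liftAddHom fun g => AddMonoidHom.mk'
    (fun r => balTmul R (SkewMonoidAlgebra R G) (single g r) (single g⁻¹ 1))
    fun r r' => by rw [single_add, balTmul_add_left]).comp
    (coeffAddEquiv (k := R) (G := G)).toAddMonoidHom

theorem twistedRed_single (g : G) (r : R) :
    twistedRed (single g r) = balTmul R (SkewMonoidAlgebra R G) (single g r) (single g⁻¹ 1) := by
  change Finsupp.liftAddHom _ (Finsupp.single g r) = _
  rw [Finsupp.liftAddHom_apply_single]
  rfl

theorem twistedRed_mem (h : SkewMonoidAlgebra R G) :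
    twistedRed h ∈ balTakeuchi R (SkewMonoidAlgebra R G) := by
  induction h using SkewMonoidAlgebra.induction_on with
  | zero => rw [map_zero]; exact zero_mem _
  | single g a =>
    intro r
    -- Written to the right of g, the scalar r becomes g⁻¹(r). It can then cross the balanced tensor
    -- sign, and there g⁻¹(r) g⁻¹ = g⁻¹ r.
    have : (single 1 r : SkewMonoidAlgebra R G) * single g a
        = single g a * incl R (SkewMonoidAlgebra R G) (g⁻¹ • r) := by
      rw [incl_twisted, single_mul_single, single_mul_single, smul_inv_smul, mul_comm a]
      simp
    rw [twistedRed_single, actB_balTmul, actB_balTmul, incl_twisted, this, balTmul_balanced,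
      mul_one, single_mul_single, SkewMonoidAlgebra.smul_single]
    simp
  | add x y hx hy => rw [map_add]; exact add_mem hx hy

theorem twistedRed_smul (r : R) (h : SkewMonoidAlgebra R G) :
    twistedRed (r • h) = actB R (SkewMonoidAlgebra R G) (incl R _ r) 1 (twistedRed h) := by
  induction h using SkewMonoidAlgebra.induction_on with
  | zero => simp
  | single g a =>
    rw [SkewMonoidAlgebra.smul_single, twistedRed_single, twistedRed_single, actB_balTmul,
      incl_mul, SkewMonoidAlgebra.smul_single, mul_one]
  | add x y hx hy => rw [smul_add, map_add, map_add, map_add, hx, hy]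

theorem twisted_isHopfAlgebroid : IsHopfAlgebroid k R (SkewMonoidAlgebra R G) where
  toIsLeftBialgebroid := twisted_isLeftBialgebroid
  galois_bijective := by
    refine galois_bijective_of_translation twistedRed twistedRed_mem twistedRed_smul _
      (fun h => ?_) fun h => ?_
    · induction h using SkewMonoidAlgebra.induction_on with
      | zero => simp
      | single g a =>
        rw [twistedRed_single, galois_balTmul, comul_single, actR_tmul, single_mul_single]
        simp
      | add x y hx hy => rw [map_add, map_add, TensorProduct.add_tmul, hx, hy]
    · induction h using SkewMonoidAlgebra.induction_on with
      | zero => simp [balTmul, toRight]; exact (TensorProduct.zero_tmul _ _).symm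
      | single g a =>
        rw [comul_single, translationLift_tmul, twistedRed_single, actB_balTmul,
          single_mul_single]
        simp
      | add x y hx hy => rw [map_add, map_add, balTmul_add_left, hx, hy]

end TwistedGroupAlgebra

end HopfAlgebroid

namespace CoxeterSystem

/-! ### Alternating products -/

section AltProd

/-- The letter in position `n` of the alternating word `s t s t ⋯`, counted from `0`. -/
def altLetter {B : Type*} (s t : B) : ℕ → B
  | 0 => s
  | n + 1 => altLetter t s n

theorem altLetter_mem {B : Type*} (s t : B) (n : ℕ) :
    (altLetter s t n = s ∧ altLetter t s n = t) ∨ (altLetter s t n = t ∧ altLetter t s n = s) := by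
  induction n generalizing s t with
  | zero => exact Or.inl ⟨rfl, rfl⟩
  | succ n ih => exact (ih t s).symm

theorem altProd_succ {A : Type*} [Monoid A] (a b : A) (n : ℕ) :
    altProd a b (n + 1) = a * altProd b a n := rfl

theorem altProd_add {A B : Type*} [Monoid A] (f : B → A) (s t : B) (n k : ℕ) :
    altProd (f s) (f t) (n + k) =
      altProd (f s) (f t) n * altProd (f (altLetter s t n)) (f (altLetter t s n)) k := by
  induction n generalizing s t with
  | zero => rw [zero_add, altProd, one_mul]; rfl
  | succ n ih =>
    rw [Nat.succ_add, Nat.succ_eq_add_one, altProd_succ, ih, altProd_succ, mul_assoc]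
    rfl

theorem altProd_succ_right {A B : Type*} [Monoid A] (f : B → A) (s t : B) (n : ℕ) :
    altProd (f s) (f t) (n + 1) = altProd (f s) (f t) n * f (altLetter s t n) := by
  rw [altProd_add, altProd_succ, altProd, mul_one]

theorem map_altProd {A A' F : Type*} [Monoid A] [Monoid A'] [FunLike F A A'] [MonoidHomClass F A A']
    (φ : F) (a b : A) (n : ℕ) : φ (altProd a b n) = altProd (φ a) (φ b) n := by
  induction n generalizing a b with
  | zero => exact map_one φ
  | succ n ih => rw [altProd_succ, map_mul, ih, altProd_succ]

theorem altProd_two_mul {A : Type*} [Monoid A] (a b : A) (n : ℕ) :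
    altProd a b (2 * n) = (a * b) ^ n := by
  induction n with
  | zero => simp [altProd]
  | succ n ih => rw [mul_add, mul_one, altProd_succ, altProd_succ, ih, pow_succ', mul_assoc]

theorem altProd_two_mul_add_one {A : Type*} [Monoid A] (a b : A) (n : ℕ) :
    altProd a b (2 * n + 1) = (a * b) ^ n * a := by
  induction n with
  | zero => simp [altProd]
  | succ n ih =>
    rw [show 2 * (n + 1) + 1 = (2 * n + 1) + 1 + 1 by ring, altProd_succ, altProd_succ, ih,
      pow_succ', mul_assoc, mul_assoc]

/-- For involutions ba = (ab)⁻¹, so bringing one alternating word to the other side produces (ab)^m,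
for even and for odd m. -/
theorem altProd_comm_of_pow_eq_one {A : Type*} [Group A] {a b : A} (ha : a * a = 1) (hb : b * b = 1)
    {m : ℕ} (h : (a * b) ^ m = 1) : altProd a b m = altProd b a m := by
  have hba : b * a = (a * b)⁻¹ := by
    rw [mul_inv_rev, inv_eq_of_mul_eq_one_right ha, inv_eq_of_mul_eq_one_right hb]
  rcases Nat.even_or_odd' m with ⟨n, rfl | rfl⟩
  · rw [altProd_two_mul, altProd_two_mul, hba, inv_pow, eq_inv_iff_mul_eq_one, ← pow_add,
      ← two_mul, h]
  · have hb' : b = b⁻¹ := (inv_eq_of_mul_eq_one_right hb).symm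
    rw [altProd_two_mul_add_one, altProd_two_mul_add_one, hba, inv_pow]
    nth_rewrite 3 [hb']
    rw [eq_mul_inv_iff_mul_eq, mul_assoc, eq_inv_iff_mul_eq_one, ← pow_succ, ← pow_add, ← h]
    congr 1
    ring

theorem altProd_simple_comm {B W : Type*} [Group W] {M : CoxeterMatrix B} (cs : CoxeterSystem M W)
    (s t : B) : altProd (cs.simple s) (cs.simple t) (M s t) =
      altProd (cs.simple t) (cs.simple s) (M s t) :=
  altProd_comm_of_pow_eq_one (cs.simple_mul_simple_self s) (cs.simple_mul_simple_self t)
    (cs.simple_mul_simple_pow s t)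

theorem length_altProd_le {B W : Type*} [Group W] {M : CoxeterMatrix B} (cs : CoxeterSystem M W)
    (s t : B) (n : ℕ) : cs.length (altProd (cs.simple s) (cs.simple t) n) ≤ n := by
  induction n generalizing s t with
  | zero => simp [altProd]
  | succ n ih =>
    rw [altProd_succ]
    have := cs.length_mul_le (cs.simple s) (altProd (cs.simple t) (cs.simple s) n)
    rw [cs.length_simple] at this
    have := ih t s
    omega

end AltProd

/-! ### Dihedral reflection groups -/

section Dihedral

variable {B : Type*} (M : CoxeterMatrix B)

theorem form_symm (x y : B →₀ ℝ) : form M x y = form M y x := by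
  have h : form M = (form M).flip := by
    refine Finsupp.lhom_ext' fun s => LinearMap.ext_ring ?_
    refine Finsupp.lhom_ext' fun t => LinearMap.ext_ring ?_
    have := form_simpleRoot M s t
    have h' := form_simpleRoot M t s
    rw [M.symmetric t s] at h'
    exact this.trans h'.symm
  exact LinearMap.congr_fun (LinearMap.congr_fun h x) y

theorem form_self (s : B) : form M (simpleRoot s) (simpleRoot s) = 1 := by
  simp [form_simpleRoot]

theorem coroot_eq_form (s : B) (x : B →₀ ℝ) : coroot M s x = 2 * form M x (simpleRoot s) := by
  simp [coroot, form_self]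

theorem geomReflection_apply (s : B) (x : B →₀ ℝ) :
    geomReflection M s x = x - coroot M s x • simpleRoot s := rfl

theorem form_geomReflection (s : B) (x y : B →₀ ℝ) :
    form M (geomReflection M s x) (geomReflection M s y) = form M x y := by
  simp only [geomReflection_apply, coroot_eq_form, map_sub, map_smul, LinearMap.sub_apply,
    LinearMap.smul_apply, smul_eq_mul, form_self, form_symm M (simpleRoot s) y]
  ring

theorem form_altProd (s t : B) (n : ℕ) (x y : B →₀ ℝ) :
    form M (altProd (geomReflection M s) (geomReflection M t) n x)
      (altProd (geomReflection M s) (geomReflection M t) n y) = form M x y := by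
  induction n generalizing s t with
  | zero => rfl
  | succ n ih =>
    rw [altProd_succ, Module.End.mul_apply, Module.End.mul_apply, form_geomReflection, ih]

theorem geomReflection_self (s : B) : geomReflection M s (simpleRoot s) = -simpleRoot s := by
  rw [geomReflection_apply, coroot_self]
  module

/-- The ratio `sin (n π / m) / sin (π / m)`. -/
def sinRatio (m n : ℕ) : ℝ := Real.sin (n * (Real.pi / m)) / Real.sin (Real.pi / m)

theorem sin_pi_div_pos {m : ℕ} (hm : 2 ≤ m) : 0 < Real.sin (Real.pi / m) := by
  have h2 : (2 : ℝ) ≤ m := by exact_mod_cast hm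
  refine Real.sin_pos_of_pos_of_lt_pi (by positivity) ?_
  rw [div_lt_iff₀ (by positivity)]
  nlinarith [Real.pi_pos]

theorem sinRatio_zero (m : ℕ) : sinRatio m 0 = 0 := by simp [sinRatio]

theorem sinRatio_one {m : ℕ} (hm : 2 ≤ m) : sinRatio m 1 = 1 := by
  simp [sinRatio, (sin_pi_div_pos hm).ne']

theorem sinRatio_add_two (m n : ℕ) :
    sinRatio m (n + 2) = 2 * Real.cos (Real.pi / m) * sinRatio m (n + 1) - sinRatio m n := by
  simp only [sinRatio]
  set θ := Real.pi / m
  have h1 : Real.sin ((n + 2 : ℕ) * θ) =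
      2 * Real.cos θ * Real.sin ((n + 1 : ℕ) * θ) - Real.sin (n * θ) := by
    rw [show ((n + 2 : ℕ) : ℝ) * θ = (n + 1 : ℕ) * θ + θ by push_cast; ring,
      show (n : ℝ) * θ = (n + 1 : ℕ) * θ - θ by push_cast; ring, Real.sin_add, Real.sin_sub]
    ring
  rw [h1]
  ring

theorem sinRatio_self {m : ℕ} (hm : 2 ≤ m) : sinRatio m m = 0 := by
  have : (m : ℝ) ≠ 0 := by positivity
  simp [sinRatio, mul_div_cancel₀ _ this]

theorem sinRatio_pred {m : ℕ} (hm : 2 ≤ m) : sinRatio m (m - 1) = 1 := by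
  have h0 : (m : ℝ) ≠ 0 := by positivity
  rw [sinRatio, Nat.cast_sub (by omega), sub_mul, mul_div_cancel₀ _ h0, Nat.cast_one, one_mul,
    Real.sin_pi_sub, div_self (sin_pi_div_pos hm).ne']

theorem sinRatio_pos {m n : ℕ} (hm : 2 ≤ m) (hn : 0 < n) (hnm : n < m) : 0 < sinRatio m n := by
  refine div_pos (Real.sin_pos_of_pos_of_lt_pi (by positivity) ?_) (sin_pi_div_pos hm)
  have h1 : (n : ℝ) < m := by exact_mod_cast hnm
  have h2 : (0 : ℝ) < m := by positivity
  rw [mul_div_assoc', div_lt_iff₀ h2, mul_comm]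
  exact mul_lt_mul_of_pos_left h1 Real.pi_pos

variable {M}

theorem two_le_of_ne {s t : B} (hst : s ≠ t) (h0 : M s t ≠ 0) : 2 ≤ M s t := by
  have := M.off_diagonal s t hst
  omega

/-- The roots of the dihedral group in simple coordinates. Applying one more reflection produces the
recurrence `sinRatio_add_two` for multiples of an angle. -/
theorem altProd_geomReflection_altLetter {s t : B} (hm : 2 ≤ M s t) (n : ℕ) :
    altProd (geomReflection M s) (geomReflection M t) n (simpleRoot (altLetter s t n)) =
      sinRatio (M s t) (n + 1) • simpleRoot s + sinRatio (M s t) n • simpleRoot t := by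
  induction n generalizing s t with
  | zero => simp [altProd, altLetter, sinRatio_zero, sinRatio_one hm]
  | succ n ih =>
    have ih' := ih (s := t) (t := s) (by rwa [M.symmetric t s])
    rw [M.symmetric t s] at ih'
    rw [altProd_succ, Module.End.mul_apply, altLetter, ih', map_add, map_smul, map_smul,
      geomReflection_self, geomReflection_apply, coroot_simpleRoot, sinRatio_add_two]
    module

theorem geomRep_simple {W : Type*} [Group W] (cs : CoxeterSystem M W) (s : B) :
    geomRep cs (cs.simple s) = geomReflection M s :=
  cs.lift_apply_simple (geomReflection_isLiftable M) s

theorem altProd_geomReflection_comm (s t : B) :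
    altProd (geomReflection M s) (geomReflection M t) (M s t) =
      altProd (geomReflection M t) (geomReflection M s) (M s t) := by
  have h := congrArg (geomRep M.toCoxeterSystem) (altProd_simple_comm M.toCoxeterSystem s t)
  simpa only [map_altProd, geomRep_simple] using h

/-- At length m - 1 the coordinates of the preceding root formula are sin π = 0 and 1, so the word
carries the simple root of the letter following it to α_s. Invariance of the form turns this into a
statement on coroots. -/
theorem coroot_altProd {s t : B} {n : ℕ} (hm : 2 ≤ M s t) (hn : n + 1 = M s t) (x : B →₀ ℝ) :
    coroot M s (altProd (geomReflection M t) (geomReflection M s) n x) =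
      coroot M (altLetter t s n) x := by
  have h := altProd_geomReflection_altLetter (s := t) (t := s) (by rwa [M.symmetric t s]) n
  rw [M.symmetric t s, hn, sinRatio_self hm, show n = M s t - 1 by omega, sinRatio_pred hm,
    zero_smul, zero_add, one_smul, show M s t - 1 = n by omega] at h
  rw [coroot_eq_form, ← h, form_altProd, coroot_eq_form]

/-! ### Commutation of alternating products with vectors -/

variable {A : Type*} [Ring A] [Algebra ℝ A] {L : (B →₀ ℝ) →ₗ[ℝ] A} {d : B → A}

/-- A Leibniz expansion in which only the deletions of the first and of the last factor survive:
deleting an inner factor puts two equal neighbours together, and d² = 0. The length is n + 2 so that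
first and last factor are distinct. -/
theorem altProd_mul_wt
    (hd : ∀ s x, d s * L x = L (geomReflection M s x) * d s + algebraMap ℝ A (coroot M s x))
    (hn : ∀ s, d s * d s = 0) (s t : B) (n : ℕ) (x : B →₀ ℝ) :
    altProd (d s) (d t) (n + 2) * L x =
      L (altProd (geomReflection M s) (geomReflection M t) (n + 2) x) * altProd (d s) (d t) (n + 2)
      + coroot M s (altProd (geomReflection M t) (geomReflection M s) (n + 1) x) •
          altProd (d t) (d s) (n + 1)
      + coroot M (altLetter s t (n + 1)) x • altProd (d s) (d t) (n + 1) := by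
  induction n generalizing s t with
  | zero =>
    simp only [altProd, altLetter, mul_one, mul_assoc, hd, mul_add,
      Module.End.mul_apply, Algebra.algebraMap_eq_smul_one, mul_smul_comm]
    rw [← mul_assoc, hd, add_mul, mul_assoc, Algebra.algebraMap_eq_smul_one, smul_mul_assoc,
      one_mul]
  | succ n ih =>
    -- The first-deletion term of the shorter word starts with `d s` and is killed by the new
    -- factor; the new first-deletion term arises from `hd`.
    rw [altProd_succ, mul_assoc, ih t s, mul_add, mul_add, ← mul_assoc, hd, add_mul, mul_smul_comm,
      mul_smul_comm, altProd_succ (d s) (d t) n, ← mul_assoc (d s) (d s), hn, zero_mul, smul_zero,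
      add_zero, mul_assoc, ← Algebra.smul_def]
    rfl

/-- The difference of the two sides of the braid relation commutes with vectors up to the action of
the longest element of the dihedral group. -/
theorem altProd_sub_mul_wt
    (hd : ∀ s x, d s * L x = L (geomReflection M s x) * d s + algebraMap ℝ A (coroot M s x))
    (hn : ∀ s, d s * d s = 0) {s t : B} (hm : 2 ≤ M s t) (x : B →₀ ℝ) :
    (altProd (d s) (d t) (M s t) - altProd (d t) (d s) (M s t)) * L x =
      L (altProd (geomReflection M s) (geomReflection M t) (M s t) x) *
        (altProd (d s) (d t) (M s t) - altProd (d t) (d s) (M s t)) := by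
  obtain ⟨n, hn2⟩ : ∃ n, M s t = n + 2 := ⟨M s t - 2, by omega⟩
  have h1 := altProd_mul_wt hd hn s t n x
  have h2 := altProd_mul_wt hd hn t s n x
  -- Now both expansions have the same two lower terms, in opposite order, with coefficients given
  -- by the coroots of the two last letters.
  rw [coroot_altProd hm (by omega)] at h1
  rw [coroot_altProd (by rwa [M.symmetric t s]) (by rw [M.symmetric t s]; omega)] at h2
  rw [← hn2] at h1 h2
  rw [sub_mul, h1, h2, mul_sub, altProd_geomReflection_comm]
  abel

/-- If a word of length n + 2 ≤ m vanished, commuting it past a vector killed by the last coroot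
would leave a multiple of the word without its first letter. The multiple is a positive number
because n + 1 < m, so the shorter word would vanish too. -/
theorem altProd_ne_zero [Nontrivial A]
    (hd : ∀ s x, d s * L x = L (geomReflection M s x) * d s + algebraMap ℝ A (coroot M s x))
    (hn : ∀ s, d s * d s = 0) {s t : B} (hm : 2 ≤ M s t) {n : ℕ} (hnm : n ≤ M s t) :
    altProd (d s) (d t) n ≠ 0 := by
  induction n generalizing s t with
  | zero => exact one_ne_zero
  | succ n ih =>
    have hm' : 2 ≤ M t s := by rwa [M.symmetric t s]
    rcases n with _ | n
    · intro h
      -- A single `d s` equal to zero would turn the commutation relation with α_s into 0 = 2.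
      have h' := hd s (simpleRoot s)
      rw [altProd_succ, altProd, mul_one] at h
      rw [h, coroot_self, zero_mul, mul_zero, zero_add, eq_comm,
        FaithfulSMul.algebraMap_eq_zero_iff] at h'
      norm_num at h'
    · intro h
      have ih' := ih hm' (by rw [M.symmetric t s]; omega)
      set c := Real.cos (Real.pi / (M s t : ℝ)) with hc
      set a := altLetter t s n with ha
      set b := altLetter t s (n + 1) with hb
      have hab : coroot M a (simpleRoot b) = -2 * c := by
        rw [coroot_simpleRoot]
        rcases altLetter_mem t s n with ⟨h1, h2⟩ | ⟨h1, h2⟩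
        · rw [ha, hb, altLetter, h1, h2, M.symmetric t s]
        · rw [ha, hb, altLetter, h1, h2]
      -- Here a is the last letter of the word. Since ⟨α_b, α_a^∨⟩ = -2c and ⟨α_a, α_a^∨⟩ = 2, this
      -- vector lies on the mirror of a, and the last-deletion term disappears.
      have h1 := altProd_mul_wt hd hn s t n (simpleRoot b + c • simpleRoot a)
      have h2 : coroot M (altLetter s t (n + 1)) (simpleRoot b + c • simpleRoot a) = 0 := by
        change coroot M a _ = 0
        rw [map_add, map_smul, hab, coroot_self, smul_eq_mul]
        ring
      have h3 : altProd (geomReflection M t) (geomReflection M s) (n + 1)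
          (simpleRoot b + c • simpleRoot a) =
          (sinRatio (M s t) (n + 2) - c * sinRatio (M s t) (n + 1)) • simpleRoot t +
          (sinRatio (M s t) (n + 1) - c * sinRatio (M s t) n) • simpleRoot s := by
        have e1 := altProd_geomReflection_altLetter hm' (n + 1)
        have e2 := altProd_geomReflection_altLetter hm' n
        rw [map_add, map_smul, e1, altProd_succ_right, Module.End.mul_apply, geomReflection_self,
          map_neg, e2, M.symmetric t s]
        module
      have h4 : coroot M s (altProd (geomReflection M t) (geomReflection M s) (n + 1)
          (simpleRoot b + c • simpleRoot a)) =
          2 * sinRatio (M s t) (n + 1) * Real.sin (Real.pi / (M s t : ℝ)) ^ 2 := by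
        rw [h3, map_add, map_smul, map_smul, coroot_self, coroot_simpleRoot, sinRatio_add_two,
          ← hc, Real.sin_sq, ← hc, smul_eq_mul, smul_eq_mul]
        ring
      rw [h, h2, h4, zero_mul, mul_zero, zero_add, zero_smul, add_zero, eq_comm, smul_eq_zero] at h1
      refine h1.elim (fun h5 => ?_) ih'
      have p1 := sinRatio_pos hm (n := n + 1) (by omega) (by omega)
      have p2 := sin_pi_div_pos hm
      have : 0 < 2 * sinRatio (M s t) (n + 1) * Real.sin (Real.pi / (M s t : ℝ)) ^ 2 := by
        positivity
      exact this.ne' h5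

end Dihedral

end CoxeterSystem

namespace CoxeterSystem

variable {B W : Type*} [Group W] {M : CoxeterMatrix B} (cs : CoxeterSystem M W)

/-! ### Demazure operators -/

section Demazure

instance : IsDomain (SymRing cs) := inferInstanceAs (IsDomain (SymmetricAlgebra ℝ (B →₀ ℝ)))

variable {cs} in
@[elab_as_elim]
theorem sym_induction {p : SymRing cs → Prop} (f : SymRing cs)
    (algebraMap : ∀ c : ℝ, p (algebraMap ℝ _ c)) (ι : ∀ x, p (symι cs x))
    (mul : ∀ f g, p f → p g → p (f * g)) (add : ∀ f g, p f → p g → p (f + g)) : p f :=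
  SymmetricAlgebra.induction (R := ℝ) (M := B →₀ ℝ) (motive := p) algebraMap ι mul add f

-- Suited to operators on R that are not R-linear but whose commutation with multiplication by a
-- vector is known, such as the difference of the two sides of a braid relation.
variable {cs} in
@[elab_as_elim]
theorem sym_induction_left {p : SymRing cs → Prop} (f : SymRing cs) (one : p 1)
    (smul : ∀ (c : ℝ) f, p f → p (c • f)) (ι_mul : ∀ x f, p f → p (symι cs x * f))
    (add : ∀ f g, p f → p g → p (f + g)) : p f := by
  suffices h : ∀ g, p g → p (f * g) by simpa using h 1 one
  induction f using sym_induction with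
  | algebraMap c => intro g hg; rw [← Algebra.smul_def]; exact smul c g hg
  | ι x => exact ι_mul x
  | mul f f' hf hf' => intro g hg; rw [mul_assoc]; exact hf _ (hf' _ hg)
  | add f f' hf hf' => intro g hg; rw [add_mul]; exact add _ _ (hf _ hg) (hf' _ hg)

theorem smul_algebraMap_sym (w : W) (c : ℝ) :
    w • algebraMap ℝ (SymRing cs) c = algebraMap ℝ (SymRing cs) c :=
  (symAct cs w).commutes c

theorem simple_smul_ι (s : B) (x : B →₀ ℝ) :
    cs.simple s • symι cs x = symι cs (geomReflection M s x) := by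
  rw [← geomRep_simple cs]
  exact symAct_ι cs _ x

/-- The simple root `α_s` as an element of `R`. -/
def symRoot (s : B) : SymRing cs := symι cs (simpleRoot s)

/-- The coroot extends to an algebra morphism from R to ℝ, which takes α_s to 2. -/
theorem symRoot_ne_zero (s : B) : symRoot cs s ≠ 0 := by
  intro h
  have h' := SymmetricAlgebra.lift_ι_apply (coroot M s) (simpleRoot s)
  rw [coroot_self] at h'
  change SymmetricAlgebra.lift (coroot M s) (symRoot cs s) = 2 at h'
  rw [h] at h'
  have h0 : SymmetricAlgebra.lift (coroot M s) (0 : SymRing cs) = 0 :=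
    map_zero (SymmetricAlgebra.lift (coroot M s))
  rw [h0] at h'
  norm_num at h'

theorem simple_smul_symRoot (s : B) : cs.simple s • symRoot cs s = -symRoot cs s := by
  rw [symRoot, simple_smul_ι, geomReflection_self, map_neg]

theorem symι_geomReflection (s : B) (x : B →₀ ℝ) :
    symι cs (geomReflection M s x) = symι cs x - coroot M s x • symRoot cs s := by
  rw [geomReflection_apply, map_sub, map_smul, symRoot]

/-- Divisibility is clear on vectors and passes to products by fg - s(f)s(g) = (f - s(f))g + s(f)(g
- s(g)), the source of the twisted Leibniz rule. -/
theorem exists_demazure (s : B) (f : SymRing cs) :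
    ∃ g, symRoot cs s * g = f - cs.simple s • f := by
  induction f using sym_induction with
  | algebraMap c => exact ⟨0, by rw [smul_algebraMap_sym, sub_self, mul_zero]⟩
  | ι x =>
    refine ⟨algebraMap ℝ _ (coroot M s x), ?_⟩
    rw [simple_smul_ι, symι_geomReflection, sub_sub_cancel, mul_comm, Algebra.smul_def]
  | mul f g hf hg =>
    obtain ⟨f', hf'⟩ := hf
    obtain ⟨g', hg'⟩ := hg
    refine ⟨f' * g + cs.simple s • f * g', ?_⟩
    rw [smul_mul']
    linear_combination g * hf' + cs.simple s • f * hg'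
  | add f g hf hg =>
    obtain ⟨f', hf'⟩ := hf
    obtain ⟨g', hg'⟩ := hg
    refine ⟨f' + g', ?_⟩
    rw [smul_add]
    linear_combination hf' + hg'

/-- The Demazure operator `f ↦ (f - s f) / α_s`. -/
def demazure (s : B) : Module.End ℝ (SymRing cs) where
  toFun f := (exists_demazure cs s f).choose
  map_add' f g := mul_left_cancel₀ (symRoot_ne_zero cs s) (by
    rw [mul_add, (exists_demazure cs s _).choose_spec, (exists_demazure cs s _).choose_spec,
      (exists_demazure cs s _).choose_spec, smul_add]
    ring)
  map_smul' c f := mul_left_cancel₀ (symRoot_ne_zero cs s) (by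
    rw [RingHom.id_apply, mul_smul_comm, (exists_demazure cs s _).choose_spec,
      (exists_demazure cs s _).choose_spec, smul_sub, smul_comm])

theorem symRoot_mul_demazure (s : B) (f : SymRing cs) :
    symRoot cs s * demazure cs s f = f - cs.simple s • f :=
  (exists_demazure cs s f).choose_spec

theorem demazure_eq {s : B} {f g : SymRing cs} (h : symRoot cs s * g = f - cs.simple s • f) :
    demazure cs s f = g :=
  mul_left_cancel₀ (symRoot_ne_zero cs s) ((symRoot_mul_demazure cs s f).trans h.symm)

theorem demazure_one (s : B) : demazure cs s 1 = 0 :=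
  demazure_eq cs (by rw [smul_one, sub_self, mul_zero])

theorem demazure_algebraMap (s : B) (c : ℝ) : demazure cs s (algebraMap ℝ _ c) = 0 :=
  demazure_eq cs (by rw [smul_algebraMap_sym, sub_self, mul_zero])

theorem demazure_ι (s : B) (x : B →₀ ℝ) :
    demazure cs s (symι cs x) = algebraMap ℝ _ (coroot M s x) :=
  demazure_eq cs (by
    rw [simple_smul_ι, symι_geomReflection, sub_sub_cancel, mul_comm, Algebra.smul_def])

theorem demazure_mul (s : B) (f g : SymRing cs) :
    demazure cs s (f * g) = demazure cs s f * g + cs.simple s • f * demazure cs s g :=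
  demazure_eq cs (by
    rw [smul_mul']
    linear_combination g * symRoot_mul_demazure cs s f +
      cs.simple s • f * symRoot_mul_demazure cs s g)

theorem demazure_ι_mul (s : B) (x : B →₀ ℝ) (f : SymRing cs) :
    demazure cs s (symι cs x * f) =
      symι cs (geomReflection M s x) * demazure cs s f + coroot M s x • f := by
  rw [demazure_mul, demazure_ι, simple_smul_ι, Algebra.smul_def, add_comm]

theorem simple_smul_smul (s : B) (f : SymRing cs) : cs.simple s • cs.simple s • f = f := by
  rw [smul_smul, cs.simple_mul_simple_self, one_smul]

theorem smul_demazure (s : B) (f : SymRing cs) : cs.simple s • demazure cs s f = demazure cs s f :=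
  (demazure_eq cs (by
    have h := congrArg (cs.simple s • ·) (symRoot_mul_demazure cs s f)
    simp only [smul_mul', smul_sub, simple_smul_symRoot, simple_smul_smul] at h
    linear_combination -h)).symm

theorem demazure_smul (s : B) (f : SymRing cs) :
    demazure cs s (cs.simple s • f) = -demazure cs s f :=
  demazure_eq cs (by
    rw [simple_smul_smul]
    linear_combination -symRoot_mul_demazure cs s f)

theorem demazure_demazure (s : B) (f : SymRing cs) : demazure cs s (demazure cs s f) = 0 :=
  demazure_eq cs (by rw [smul_demazure, sub_self, mul_zero])

end Demazure

/-! ### Morphisms out of the nil Hecke algebra -/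

section Lift

/-- The braid relations need to be checked only for finite `m_{st}` and different `s`, `t`. -/
theorem braid_of_ne {A : Type*} [Ring A] {d : B → A}
    (h : ∀ s t, 2 ≤ M s t →
      altProd (d s) (d t) (M s t) = altProd (d t) (d s) (M s t))
    (s t : B) : altProd (d s) (d t) (M s t) = altProd (d t) (d s) (M s t) := by
  by_cases hst : s = t
  · rw [hst]
  · rcases Nat.eq_zero_or_pos (M s t) with h0 | hpos
    · rw [h0]; rfl
    · exact h s t (two_le_of_ne hst hpos.ne')

variable {A : Type*} [Ring A] [Algebra ℝ A]

/-- The algebra morphism from the nil Hecke algebra given by images of the generators. -/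
def nhLift (L : (B →₀ ℝ) →ₗ[ℝ] A) (d : B → A) (hc : ∀ x y, L x * L y = L y * L x)
    (hd : ∀ s x, d s * L x = L (geomReflection M s x) * d s + algebraMap ℝ A (coroot M s x))
    (hn : ∀ s, d s * d s = 0)
    (hb : ∀ s t, altProd (d s) (d t) (M s t) = altProd (d t) (d s) (M s t)) :
    NilHecke cs →ₐ[ℝ] A :=
  RingQuot.liftAlgHom ℝ ⟨FreeAlgebra.lift ℝ (Sum.elim L d), by
    intro a b h
    cases h with
    | add x y => simp
    | smul c x => simp
    | comm x y => simpa using hc x y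
    | twistedWeyl s x => simpa using hd s x
    | nil s => simpa using hn s
    | braid s t => simpa [map_altProd] using hb s t⟩

variable {L : (B →₀ ℝ) →ₗ[ℝ] A} {d : B → A} {hc : ∀ x y, L x * L y = L y * L x}
    {hd : ∀ s x, d s * L x = L (geomReflection M s x) * d s + algebraMap ℝ A (coroot M s x)}
    {hn : ∀ s, d s * d s = 0}
    {hb : ∀ s t, altProd (d s) (d t) (M s t) = altProd (d t) (d s) (M s t)}

@[simp] theorem nhLift_wt (x : B →₀ ℝ) : nhLift cs L d hc hd hn hb (wt cs x) = L x := by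
  change RingQuot.liftAlgHom ℝ _ (RingQuot.mkAlgHom ℝ (NilHeckeRel M) (freeWt x)) = _
  rw [RingQuot.liftAlgHom_mkAlgHom_apply]
  simp

@[simp] theorem nhLift_del (s : B) : nhLift cs L d hc hd hn hb (del cs s) = d s := by
  change RingQuot.liftAlgHom ℝ _ (RingQuot.mkAlgHom ℝ (NilHeckeRel M) (freeDel s)) = _
  rw [RingQuot.liftAlgHom_mkAlgHom_apply]
  simp

variable {cs} in
@[elab_as_elim]
theorem nh_induction {p : NilHecke cs → Prop} (h : NilHecke cs) (one : p 1)
    (smul : ∀ (c : ℝ) h, p h → p (c • h)) (wt_mul : ∀ x h, p h → p (wt cs x * h))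
    (del_mul : ∀ s h, p h → p (del cs s * h)) (add : ∀ h h', p h → p h' → p (h + h')) : p h := by
  obtain ⟨a, rfl⟩ : ∃ a, nhMk cs a = h := RingQuot.mkAlgHom_surjective ℝ (NilHeckeRel M) h
  -- Stated as preservation of `p` under left multiplication, the claim is stable under products.
  suffices H : ∀ g, p g → p (nhMk cs a * g) by simpa using H 1 one
  induction a using FreeAlgebra.induction with
  | grade0 c =>
    intro g hg
    rw [AlgHom.commutes, ← Algebra.smul_def]
    exact smul c g hg
  | grade1 x =>
    rcases x with x | s
    · exact wt_mul x
    · exact del_mul s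
  | mul a b ha hb => intro g hg; rw [map_mul, mul_assoc]; exact ha _ (hb _ hg)
  | add a b ha hb => intro g hg; rw [map_add, add_mul]; exact add _ _ (ha _ hg) (hb _ hg)

end Lift

/-! ### Relations in the nil Hecke algebra -/

section Relations

theorem del_mul_wt (s : B) (x : B →₀ ℝ) : del cs s * wt cs x =
    wt cs (geomReflection M s x) * del cs s + algebraMap ℝ _ (coroot M s x) := by
  have h := nhMk_rel cs (.twistedWeyl s x)
  rwa [map_mul, map_add, map_mul, AlgHom.commutes] at h

theorem del_mul_del (s : B) : del cs s * del cs s = 0 := by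
  have h := nhMk_rel cs (.nil s)
  rwa [map_mul, map_zero] at h

theorem altProd_del_comm (s t : B) :
    altProd (del cs s) (del cs t) (M s t) = altProd (del cs t) (del cs s) (M s t) := by
  have h := nhMk_rel cs (.braid s t)
  rwa [map_altProd, map_altProd] at h

theorem del_mul_sym (s : B) (r : SymRing cs) : del cs s * symIncl cs r =
    symIncl cs (cs.simple s • r) * del cs s + symIncl cs (demazure cs s r) := by
  induction r using sym_induction with
  | algebraMap c =>
    rw [smul_algebraMap_sym, demazure_algebraMap, map_zero, add_zero, AlgHom.commutes,
      Algebra.commutes]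
  | ι x =>
    rw [simple_smul_ι, demazure_ι, symIncl_ι, symIncl_ι, AlgHom.commutes, del_mul_wt]
  | mul f g hf hg =>
    rw [map_mul, ← mul_assoc, hf, add_mul, mul_assoc, hg, demazure_mul, smul_mul']
    simp only [map_mul, map_add]
    noncomm_ring
  | add f g hf hg =>
    rw [map_add, mul_add, hf, hg, smul_add]
    simp only [map_add]
    noncomm_ring

theorem reflElt_eq (s : B) : reflElt cs s = 1 - symIncl cs (symRoot cs s) * del cs s := by
  rw [symRoot, symIncl_ι]; rfl

theorem simple_smul_eq (s : B) (r : SymRing cs) :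
    cs.simple s • r = r - symRoot cs s * demazure cs s r := by
  rw [symRoot_mul_demazure, sub_sub_cancel]

/-- The error term is now a multiple of s instead of 1. This form and `del_mul_sym` match the two
factors in the Takeuchi condition for Δ(∂_s). -/
theorem del_mul_sym' (s : B) (r : SymRing cs) : del cs s * symIncl cs r =
    symIncl cs (demazure cs s r) * reflElt cs s + symIncl cs r * del cs s := by
  rw [del_mul_sym, simple_smul_eq, reflElt_eq, map_sub, mul_comm (symRoot cs s), map_mul]
  noncomm_ring

theorem reflElt_mul_sym (s : B) (r : SymRing cs) :
    reflElt cs s * symIncl cs r = symIncl cs (cs.simple s • r) * reflElt cs s := by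
  have h := congrArg (symIncl cs) (symRoot_mul_demazure cs s r)
  rw [map_mul, map_sub] at h
  rw [reflElt_eq, sub_mul, mul_assoc, del_mul_sym, mul_add, h, ← mul_assoc, ← map_mul, mul_sub,
    ← mul_assoc, ← map_mul, mul_comm (symRoot cs s)]
  noncomm_ring

theorem del_mul_symRoot (s : B) : del cs s * symIncl cs (symRoot cs s) =
    -(symIncl cs (symRoot cs s) * del cs s) + 2 := by
  rw [del_mul_sym, simple_smul_symRoot, map_neg, neg_mul, symRoot, demazure_ι, coroot_self,
    AlgHom.commutes, map_ofNat]

theorem del_mul_reflElt (s : B) : del cs s * reflElt cs s = -del cs s := by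
  rw [reflElt_eq, mul_sub, ← mul_assoc, del_mul_symRoot, add_mul, neg_mul, mul_assoc, del_mul_del]
  noncomm_ring

theorem reflElt_mul_del (s : B) : reflElt cs s * del cs s = del cs s := by
  rw [reflElt_eq, sub_mul, mul_assoc, del_mul_del, mul_zero, sub_zero, one_mul]

theorem reflElt_mul_reflElt (s : B) : reflElt cs s * reflElt cs s = 1 := by
  nth_rewrite 1 [reflElt_eq]
  rw [sub_mul, mul_assoc, del_mul_reflElt, reflElt_eq]
  noncomm_ring

end Relations

/-! ### The polynomial representation -/

section Polynomial

/-- Multiplication by a vector on `R`. -/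
def symMulι : (B →₀ ℝ) →ₗ[ℝ] Module.End ℝ (SymRing cs) :=
  (Algebra.lmul ℝ (SymRing cs)).toLinearMap ∘ₗ symι cs

theorem symMulι_apply (x : B →₀ ℝ) (f : SymRing cs) : symMulι cs x f = symι cs x * f := rfl

theorem demazure_mul_symMulι (s : B) (x : B →₀ ℝ) : demazure cs s * symMulι cs x =
    symMulι cs (geomReflection M s x) * demazure cs s + algebraMap ℝ _ (coroot M s x) :=
  LinearMap.ext fun f => demazure_ι_mul cs s x f

theorem demazure_mul_demazure (s : B) : demazure cs s * demazure cs s = 0 :=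
  LinearMap.ext fun f => demazure_demazure cs s f

theorem altProd_demazure_one (s t : B) {n : ℕ} (hn : n ≠ 0) :
    altProd (demazure cs s) (demazure cs t) n 1 = 0 := by
  obtain ⟨n, rfl⟩ := Nat.exists_eq_succ_of_ne_zero hn
  rw [Nat.succ_eq_add_one, altProd_succ_right (demazure cs), Module.End.mul_apply, demazure_one,
    map_zero]

/-- The difference of the two sides commutes with multiplication by vectors up to w₀ and kills 1,
since Demazure operators do; so it kills all of R. -/
theorem altProd_demazure_comm (s t : B) :
    altProd (demazure cs s) (demazure cs t) (M s t) =
      altProd (demazure cs t) (demazure cs s) (M s t) := by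
  refine braid_of_ne (fun s t hm => sub_eq_zero.1 (LinearMap.ext fun f => ?_)) s t
  have h := altProd_sub_mul_wt (demazure_mul_symMulι cs) (demazure_mul_demazure cs) hm
  set Z := altProd (demazure cs s) (demazure cs t) (M s t) -
    altProd (demazure cs t) (demazure cs s) (M s t) with hZ
  rw [LinearMap.zero_apply]
  induction f using sym_induction_left with
  | one =>
    rw [hZ, LinearMap.sub_apply, altProd_demazure_one cs s t (by omega),
      altProd_demazure_one cs t s (by omega), sub_zero]
  | smul c f hf => rw [map_smul, hf, smul_zero]
  | ι_mul x f hf =>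
    have h' := LinearMap.congr_fun (h x) f
    rw [Module.End.mul_apply, Module.End.mul_apply, hf, map_zero] at h'
    exact h'
  | add f g hf hg => rw [map_add, hf, hg, add_zero]

/-- The polynomial representation of the nil Hecke algebra, by Demazure operators. -/
def polyRep : NilHecke cs →ₐ[ℝ] Module.End ℝ (SymRing cs) :=
  nhLift cs (symMulι cs) (demazure cs)
    (fun x y => LinearMap.ext fun f => mul_left_comm (symι cs x) (symι cs y) f)
    (demazure_mul_symMulι cs) (demazure_mul_demazure cs) (altProd_demazure_comm cs)

theorem polyRep_wt (x : B →₀ ℝ) : polyRep cs (wt cs x) = symMulι cs x := nhLift_wt cs x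

theorem polyRep_del (s : B) : polyRep cs (del cs s) = demazure cs s := nhLift_del cs s

theorem polyRep_sym (r f : SymRing cs) : polyRep cs (symIncl cs r) f = r * f := by
  induction r using sym_induction generalizing f with
  | algebraMap c =>
    rw [AlgHom.commutes, AlgHom.commutes, Module.algebraMap_end_apply, Algebra.smul_def]
  | ι x => rw [symIncl_ι, polyRep_wt, symMulι_apply]
  | mul r r' hr hr' => rw [map_mul, map_mul, Module.End.mul_apply, hr', hr, mul_assoc]
  | add r r' hr hr' => rw [map_add, map_add, LinearMap.add_apply, hr, hr', add_mul]

theorem polyRep_smul (r : SymRing cs) (h : NilHecke cs) (f : SymRing cs) :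
    polyRep cs (r • h) f = r * polyRep cs h f := by
  rw [sym_smul_def, map_mul, Module.End.mul_apply, polyRep_sym]

theorem polyRep_reflElt (s : B) (f : SymRing cs) :
    polyRep cs (reflElt cs s) f = cs.simple s • f := by
  rw [reflElt_eq, map_sub, map_mul, map_one, LinearMap.sub_apply, Module.End.mul_apply,
    polyRep_sym, polyRep_del, simple_smul_eq, Module.End.one_apply]

end Polynomial

/-! ### The nil Coxeter module -/

section NilModule

open scoped Classical in
/-- The operator `r e_w ↦ ∂_s(r) e_w + s(r) T_s(e_w)` on the free `R`-module with basis `W`, where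
`T_s(e_w)` is `e_{sw}` if `sw` is longer than `w`, and `0` otherwise. -/
def nilDel (s : B) : Module.End ℝ (W →₀ SymRing cs) :=
  Finsupp.lsum ℝ fun w => Finsupp.lsingle w ∘ₗ demazure cs s +
    if cs.length (cs.simple s * w) = cs.length w + 1 then
      Finsupp.lsingle (cs.simple s * w) ∘ₗ (symAct cs (cs.simple s)).toLinearMap else 0

open scoped Classical in
theorem nilDel_single (s : B) (w : W) (r : SymRing cs) :
    nilDel cs s (Finsupp.single w r) = Finsupp.single w (demazure cs s r) +
      if cs.length (cs.simple s * w) = cs.length w + 1 then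
        Finsupp.single (cs.simple s * w) (cs.simple s • r) else 0 := by
  rw [nilDel, Finsupp.lsum_single, LinearMap.add_apply]
  split_ifs <;> rfl

/-- Multiplication by a vector on the free `R`-module with basis `W`. -/
def nilWt : (B →₀ ℝ) →ₗ[ℝ] Module.End ℝ (W →₀ SymRing cs) :=
  (Algebra.lsmul ℝ ℝ (W →₀ SymRing cs)).toLinearMap ∘ₗ symι cs

theorem nilWt_apply (x : B →₀ ℝ) (y : W →₀ SymRing cs) : nilWt cs x y = symι cs x • y := rfl

theorem nilDel_mul_nilWt (s : B) (x : B →₀ ℝ) : nilDel cs s * nilWt cs x =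
    nilWt cs (geomReflection M s x) * nilDel cs s + algebraMap ℝ _ (coroot M s x) := by
  refine Finsupp.lhom_ext fun w r => ?_
  rw [LinearMap.add_apply, Module.End.mul_apply, Module.End.mul_apply, nilWt_apply, nilWt_apply,
    Finsupp.smul_single, nilDel_single, nilDel_single, Module.algebraMap_end_apply, smul_eq_mul,
    demazure_ι_mul, smul_mul', simple_smul_ι, smul_add, Finsupp.smul_single, Finsupp.smul_single,
    Finsupp.single_add, smul_ite, smul_zero, Finsupp.smul_single, smul_eq_mul, smul_eq_mul]
  abel

/-- The coefficient at e_{sw} is s(∂_s r) + ∂_s(s r) = ∂_s r - ∂_s r, and going up twice by s is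
impossible. -/
theorem nilDel_mul_nilDel (s : B) : nilDel cs s * nilDel cs s = 0 := by
  refine Finsupp.lhom_ext fun w r => ?_
  rw [Module.End.mul_apply, nilDel_single, map_add, nilDel_single, demazure_demazure,
    smul_demazure, LinearMap.zero_apply]
  split_ifs with h
  · rw [nilDel_single, cs.simple_mul_simple_cancel_left, if_neg (by omega), demazure_smul,
      Finsupp.single_neg]
    simp
  · simp

-- Starting with coefficient 1 the Demazure part never contributes, so only the nil Coxeter action
-- on W is left. The length condition says that every letter has increased the length.
open scoped Classical in
theorem altProd_nilDel_single (s t : B) (n : ℕ) (w : W) :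
    altProd (nilDel cs s) (nilDel cs t) n (Finsupp.single w 1) =
      if cs.length (altProd (cs.simple s) (cs.simple t) n * w) = n + cs.length w then
        Finsupp.single (altProd (cs.simple s) (cs.simple t) n * w) 1 else 0 := by
  induction n generalizing s t with
  | zero => simp [altProd]
  | succ n ih =>
    rw [altProd_succ, Module.End.mul_apply, ih, altProd_succ, mul_assoc]
    set u := altProd (cs.simple t) (cs.simple s) n
    have h1 : cs.length (u * w) ≤ n + cs.length w :=
      (cs.length_mul_le u w).trans (Nat.add_le_add_right (length_altProd_le cs t s n) _)
    have h2 := cs.length_mul_le (cs.simple s) (u * w)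
    rw [cs.length_simple] at h2
    split_ifs with h3 h4 h4
    · rw [nilDel_single, demazure_one, Finsupp.single_zero, zero_add, if_pos (by omega), smul_one]
    · rw [nilDel_single, demazure_one, Finsupp.single_zero, zero_add, if_neg (by omega)]
    · omega
    · rw [map_zero]

/-- On e_w both sides are governed by the same element of W, by the braid relation there.
Commutation with vectors up to w₀ extends the vanishing of the difference to all r e_w. -/
theorem altProd_nilDel_comm (s t : B) :
    altProd (nilDel cs s) (nilDel cs t) (M s t) = altProd (nilDel cs t) (nilDel cs s) (M s t) := by
  refine braid_of_ne (d := nilDel cs) (fun s t hm => sub_eq_zero.1 ?_) s t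
  refine Finsupp.lhom_ext fun w r => ?_
  have h := altProd_sub_mul_wt (L := nilWt cs) (d := nilDel cs) (nilDel_mul_nilWt cs)
    (nilDel_mul_nilDel cs) hm
  set Z := altProd (nilDel cs s) (nilDel cs t) (M s t) -
    altProd (nilDel cs t) (nilDel cs s) (M s t) with hZ
  rw [LinearMap.zero_apply]
  induction r using sym_induction_left with
  | one =>
    rw [hZ, LinearMap.sub_apply, altProd_nilDel_single, altProd_nilDel_single, altProd_simple_comm,
      sub_self]
  | smul c f hf => rw [← Finsupp.smul_single, map_smul, hf, smul_zero]
  | ι_mul x f hf =>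
    have h' := LinearMap.congr_fun (h x) (Finsupp.single w f)
    rw [Module.End.mul_apply, Module.End.mul_apply, hf, map_zero, nilWt_apply, Finsupp.smul_single,
      smul_eq_mul] at h'
    exact h'
  | add f g hf hg => rw [Finsupp.single_add, map_add, hf, hg, add_zero]

/-- The representation of the nil Hecke algebra on the free `R`-module with basis `W`. -/
def nilRep : NilHecke cs →ₐ[ℝ] Module.End ℝ (W →₀ SymRing cs) :=
  nhLift cs (nilWt cs) (nilDel cs)
    (fun x y => LinearMap.ext fun f => smul_comm (symι cs x) (symι cs y) f)
    (nilDel_mul_nilWt cs) (nilDel_mul_nilDel cs) (altProd_nilDel_comm cs)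

theorem nilRep_wt (x : B →₀ ℝ) : nilRep cs (wt cs x) = nilWt cs x := nhLift_wt cs x

theorem nilRep_del (s : B) : nilRep cs (del cs s) = nilDel cs s := nhLift_del cs s

theorem nilRep_sym (r : SymRing cs) (y : W →₀ SymRing cs) :
    nilRep cs (symIncl cs r) y = r • y := by
  induction r using sym_induction generalizing y with
  | algebraMap c =>
    rw [AlgHom.commutes, AlgHom.commutes, Module.algebraMap_end_apply, algebraMap_smul]
  | ι x => rw [symIncl_ι, nilRep_wt, nilWt_apply]
  | mul r r' hr hr' => rw [map_mul, map_mul, Module.End.mul_apply, hr', hr, mul_smul]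
  | add r r' hr hr' => rw [map_add, map_add, LinearMap.add_apply, hr, hr', add_smul]

-- The diagonal part of 1 - α_s ∂_s is r - α_s ∂_s(r) = s(r). The only other contribution at v comes
-- from e_{sv}, provided that s lengthens sv.
open scoped Classical in
theorem nilRep_reflElt_apply (s : B) (y : W →₀ SymRing cs) (v : W) :
    nilRep cs (reflElt cs s) y v = cs.simple s • y v -
      if cs.length v = cs.length (cs.simple s * v) + 1 then
        symRoot cs s * cs.simple s • y (cs.simple s * v) else 0 := by
  rw [reflElt_eq, map_sub, map_mul, map_one, LinearMap.sub_apply, Module.End.mul_apply,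
    nilRep_sym, nilRep_del, Module.End.one_apply, Finsupp.sub_apply, Finsupp.smul_apply]
  induction y using Finsupp.induction_linear with
  | zero => simp
  | add y y' hy hy' =>
    simp only [map_add, Finsupp.add_apply, smul_add, mul_add] at hy hy' ⊢
    rw [add_sub_add_comm, hy, hy']
    split_ifs <;> abel
  | single w r =>
    rw [nilDel_single, simple_smul_eq cs s ((Finsupp.single w r) v)]
    have e : w = cs.simple s * v ↔ cs.simple s * w = v := by
      constructor <;> rintro rfl <;> rw [cs.simple_mul_simple_cancel_left]
    by_cases hv : w = v
    · subst hv
      have hne : cs.simple s * w ≠ w := fun h => by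
        have := cs.length_simple_mul w s
        rw [h] at this
        omega
      have h1 : (Finsupp.single w r) (cs.simple s * w) = 0 := by
        rw [Finsupp.single_apply, if_neg hne.symm]
      rw [h1, smul_zero, mul_zero, ite_self, sub_zero, Finsupp.add_apply, Finsupp.single_eq_same,
        Finsupp.single_eq_same]
      split_ifs <;> simp [hne]
    · by_cases hsv : cs.simple s * w = v
      · subst hsv
        rw [cs.simple_mul_simple_cancel_left]
        split_ifs <;> simp [hv]
      · have h1 : (Finsupp.single w r) (cs.simple s * v) = 0 := by
          rw [Finsupp.single_apply, if_neg (fun h => hsv (e.1 h))]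
        rw [h1]
        split_ifs <;> simp [hv, hsv]

end NilModule

end CoxeterSystem

namespace CoxeterSystem

/-! ### Alternating words in two letters -/

section BinaryWords

/-- The letter which follows the alternating word of length `n` starting with `b`. -/
def nextLetter (b : Bool) (n : ℕ) : Bool := altLetter b (!b) n

theorem altLetter_not (b : Bool) (n : ℕ) : altLetter (!b) b n = !nextLetter b n := by
  rcases altLetter_mem b (!b) n with ⟨h1, h2⟩ | ⟨h1, h2⟩ <;> simp [nextLetter, h1, h2]

theorem nextLetter_succ (b : Bool) (n : ℕ) : nextLetter b (n + 1) = !nextLetter b n :=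
  altLetter_not b n

theorem nextLetter_injective {b b' : Bool} {n : ℕ} (h : nextLetter b n = nextLetter b' n) :
    b = b' := by
  by_contra hb
  obtain rfl : b' = !b := by cases b <;> cases b' <;> simp_all
  rw [nextLetter, nextLetter, Bool.not_not, altLetter_not, ← nextLetter] at h
  simp at h

variable {A : Type*} [Ring A] (D : Bool → A)

/-- The alternating product of length `p.2` which starts with the letter `p.1`. -/
def altWord (p : Bool × ℕ) : A := altProd (D p.1) (D !p.1) p.2

theorem altWord_zero (b : Bool) : altWord D (b, 0) = 1 := rfl

theorem altWord_succ (b : Bool) (n : ℕ) : altWord D (b, n + 1) = D b * altWord D (!b, n) := by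
  simp [altWord, altProd_succ]

theorem altWord_add (b : Bool) (n k : ℕ) :
    altWord D (b, n + k) = altWord D (b, n) * altWord D (nextLetter b n, k) := by
  simp only [altWord, altProd_add D, altLetter_not, nextLetter]

theorem altWord_succ_right (b : Bool) (n : ℕ) :
    altWord D (b, n + 1) = altWord D (b, n) * D (nextLetter b n) := by
  rw [altWord_add, altWord_succ, altWord_zero, mul_one]

variable {D}

theorem altWord_mul_eq_zero (hn : ∀ b, D b * D b = 0) {b c : Bool} {n k : ℕ} (hn0 : n ≠ 0)
    (hk0 : k ≠ 0) (hc : c ≠ nextLetter b n) : altWord D (b, n) * altWord D (c, k) = 0 := by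
  obtain ⟨n, rfl⟩ := Nat.exists_eq_succ_of_ne_zero hn0
  obtain ⟨k, rfl⟩ := Nat.exists_eq_succ_of_ne_zero hk0
  rw [Nat.succ_eq_add_one, Nat.succ_eq_add_one] at *
  rw [nextLetter_succ] at hc
  obtain rfl : c = nextLetter b n := by
    cases c <;> cases h : nextLetter b n <;> simp_all
  rw [altWord_succ_right, altWord_succ, mul_assoc, ← mul_assoc (D _) (D _), hn, zero_mul, mul_zero]

theorem altWord_comm {m : ℕ}
    (hb : altProd (D true) (D false) m = altProd (D false) (D true) m) (b c : Bool) :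
    altWord D (b, m) = altWord D (c, m) := by
  cases b <;> cases c <;> simp [altWord, hb]

/-- After the first letter b, the next m letters may be replaced by the word that also starts with
b, which creates a square. -/
theorem altWord_eq_zero (hn : ∀ b, D b * D b = 0) {m : ℕ} (hm : m ≠ 0)
    (hb : altProd (D true) (D false) m = altProd (D false) (D true) m) {b : Bool} {n : ℕ}
    (hnm : m < n) : altWord D (b, n) = 0 := by
  obtain ⟨k, rfl⟩ : ∃ k, n = m + 1 + k := ⟨n - (m + 1), by omega⟩
  obtain ⟨l, rfl⟩ := Nat.exists_eq_succ_of_ne_zero hm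
  rw [altWord_add, altWord_succ, altWord_comm hb (!b) b, Nat.succ_eq_add_one, altWord_succ,
    ← mul_assoc (D b), hn, zero_mul, zero_mul]

/-- The alternating words of length at most `m`, where the two words of length `m`, and those of
length `0`, are not distinguished. -/
abbrev WordIndex (m : ℕ) : Type :=
  {p : Bool × ℕ // p.2 ≤ m ∧ (p.1 = true ∨ (0 < p.2 ∧ p.2 < m))}

/-- The right factor completes the word i to the longest word. This is the triangularity that makes
complementary words test for the coefficient of i once shorter words are gone. -/
theorem altWord_mul_complement (hn : ∀ b, D b * D b = 0) {m : ℕ} (hm : m ≠ 0)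
    (hb : altProd (D true) (D false) m = altProd (D false) (D true) m) {i j : WordIndex m}
    (hij : j ≠ i) (hle : i.1.2 ≤ j.1.2) :
    altWord D j.1 * altWord D (nextLetter i.1.1 i.1.2, m - i.1.2) = 0 := by
  obtain ⟨⟨b, n⟩, hi, hi'⟩ := i
  obtain ⟨⟨c, k⟩, hj, hj'⟩ := j
  simp only [ne_eq, Subtype.mk.injEq, Prod.mk.injEq] at *
  -- If the next letters agree, the product is alternating and longer than m; equal lengths would
  -- force j = i. Otherwise a letter is repeated at the junction, and the identifications at lengths
  -- 0 and m exclude empty factors.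
  by_cases h : nextLetter b n = nextLetter c k
  · rw [h, ← altWord_add]
    refine altWord_eq_zero hn hm hb ?_
    have : k ≠ n := by
      rintro rfl
      exact hij ⟨(nextLetter_injective h).symm, rfl⟩
    omega
  · refine altWord_mul_eq_zero hn ?_ ?_ h
    · rintro rfl
      obtain rfl : n = 0 := by omega
      simp_all
    · intro h0
      obtain rfl : n = m := by omega
      obtain rfl : k = n := by omega
      simp_all

end BinaryWords

/-! ### Detecting zero in a tensor square by pairs of functionals -/

section TensorIndependence

variable {R N ι F : Type*} [CommRing R] [AddCommGroup N] [Module R N]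

/-- The bilinear pairing `x ⊗ y ↦ e(x) e'(y)`. -/
def tensorEval (e e' : N →ₗ[R] R) : N ⊗[R] N →ₗ[R] R :=
  TensorProduct.lift ((LinearMap.mul R R).compl₁₂ e e')

@[simp] theorem tensorEval_tmul (e e' : N →ₗ[R] R) (x y : N) :
    tensorEval e e' (x ⊗ₜ[R] y) = e x * e' y := rfl

/-- Independence of the value families f ↦ e_f(x_i) is applied in each tensor factor separately. It
replaces a basis of the whole module: only the span of the x_i ⊗ x_j is involved. -/
theorem eq_zero_of_tensorEval {x : ι → N} {e : F → N →ₗ[R] R}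
    (hx : LinearIndependent R fun i => fun f => e f (x i)) {z : N ⊗[R] N}
    (hz : z ∈ Submodule.span R (Set.range fun p : ι × ι => x p.1 ⊗ₜ[R] x p.2))
    (h : ∀ f g, tensorEval (e f) (e g) z = 0) : z = 0 := by
  obtain ⟨c, rfl⟩ := Finsupp.mem_span_range_iff_exists_finsupp.1 hz
  suffices hc : c = 0 by simp [hc]
  have h1 : ∀ f g, (c.curry.sum fun i d => (d.sum fun j r => r * e g (x j)) * e f (x i)) = 0 := by
    intro f g
    rw [← h f g, map_finsuppSum]
    simp only [map_smul, tensorEval_tmul, smul_eq_mul]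
    rw [← Finsupp.sum_curry_index c (fun i j r => r * (e f (x i) * e g (x j)))]
    refine Finsupp.sum_congr fun i _ => ?_
    rw [Finsupp.sum_mul]
    refine Finsupp.sum_congr fun j _ => ?_
    ring
  -- With g fixed, independence in the first factor removes the sum over i; the same argument in the
  -- second factor follows.
  have h2 : ∀ g, ∀ i ∈ c.curry.support, ((c.curry i).sum fun j r => r * e g (x j)) = 0 := by
    intro g
    refine linearIndependent_iff'.1 hx _ _ ?_
    funext f
    have := h1 f g
    rw [Finsupp.sum] at this
    simpa using this
  have h3 : c.curry = 0 := by
    by_contra hne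
    obtain ⟨i, hi⟩ := Finsupp.support_nonempty_iff.2 hne
    refine Finsupp.mem_support_iff.1 hi (linearIndependent_iff.1 hx _ ?_)
    funext g
    have := h2 g i hi
    rw [Finsupp.linearCombination_apply, Finsupp.sum, Finset.sum_apply]
    simpa [Finsupp.sum] using this
  ext ⟨i, j⟩
  rw [← Finsupp.curry_apply, h3]
  rfl

end TensorIndependence

/-! ### The nil Hecke algebra as a left R-module -/

variable {B W : Type*} [Group W] {M : CoxeterMatrix B} (cs : CoxeterSystem M W)

theorem incl_nh (r : SymRing cs) : incl (SymRing cs) (NilHecke cs) r = symIncl cs r :=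
  mul_one (symIncl cs r)

theorem symIncl_eq_smul_one (r : SymRing cs) : symIncl cs r = r • (1 : NilHecke cs) :=
  (mul_one (symIncl cs r)).symm

theorem del_mul_smul (s : B) (r : SymRing cs) (h : NilHecke cs) :
    del cs s * r • h = (cs.simple s • r) • (del cs s * h) + demazure cs s r • h := by
  simp only [sym_smul_def]
  rw [← mul_assoc, del_mul_sym, add_mul, mul_assoc]

theorem del_mul_smul' (s : B) (r : SymRing cs) (h : NilHecke cs) :
    del cs s * r • h = demazure cs s r • (reflElt cs s * h) + r • (del cs s * h) := by
  simp only [sym_smul_def]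
  rw [← mul_assoc, del_mul_sym', add_mul, mul_assoc, mul_assoc]

theorem reflElt_mul_smul (s : B) (r : SymRing cs) (h : NilHecke cs) :
    reflElt cs s * r • h = (cs.simple s • r) • (reflElt cs s * h) := by
  simp only [sym_smul_def]
  rw [← mul_assoc, reflElt_mul_sym, mul_assoc]

theorem reflElt_mul (s : B) (h : NilHecke cs) :
    reflElt cs s * h = h - symRoot cs s • (del cs s * h) := by
  rw [sym_smul_def, reflElt_eq, sub_mul, one_mul, mul_assoc]

/-- Evaluation of the polynomial representation at `f`, as an `R`-linear form. -/
def polyEval (f : SymRing cs) : NilHecke cs →ₗ[SymRing cs] SymRing cs where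
  toFun h := polyRep cs h f
  map_add' h h' := by rw [map_add, LinearMap.add_apply]
  map_smul' r h := polyRep_smul cs r h f

theorem polyEval_apply (f : SymRing cs) (h : NilHecke cs) : polyEval cs f h = polyRep cs h f := rfl

/-! ### The dihedral subalgebras -/

section DihedralSubalgebra

/-- The two generators `∂_s` and `∂_t`. -/
def del₂ (s t : B) (b : Bool) : NilHecke cs := del cs (bif b then s else t)

variable {s t : B}

theorem del₂_mul_self (b : Bool) : del₂ cs s t b * del₂ cs s t b = 0 := del_mul_del cs _

theorem del₂_braid : altProd (del₂ cs s t true) (del₂ cs s t false) (M s t) =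
    altProd (del₂ cs s t false) (del₂ cs s t true) (M s t) := altProd_del_comm cs s t

theorem polyRep_altWord_ne_zero (hm : 2 ≤ M s t) (b : Bool) :
    polyRep cs (altWord (del₂ cs s t) (b, M s t)) ≠ 0 := by
  rw [altWord, map_altProd]
  have h := fun (s' t' : B) (hm' : 2 ≤ M s' t') => altProd_ne_zero (L := symMulι cs)
    (d := demazure cs) (demazure_mul_symMulι cs) (demazure_mul_demazure cs) hm' le_rfl
  cases b
  · have h' := h t s (by rwa [M.symmetric t s])
    rw [M.symmetric t s] at h'
    simpa [del₂, polyRep_del] using h'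
  · simpa [del₂, polyRep_del] using h s t hm

/-- By induction on word length. Evaluating a relation at ρ(u)f, with u complementary to the word i,
leaves only the coefficient of i times the longest word applied to f, and R is a domain. -/
theorem linearIndependent_altWord (hm : 2 ≤ M s t) :
    LinearIndependent (SymRing cs) fun i : WordIndex (M s t) => fun f =>
      polyEval cs f (altWord (del₂ cs s t) i.1) := by
  refine linearIndependent_iff'.2 fun S g hg => ?_
  suffices H : ∀ n, ∀ i ∈ S, i.1.2 = n → g i = 0 from fun i hi => H _ i hi rfl
  intro n
  induction n using Nat.strong_induction_on with
  | _ n ih =>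
    intro i hi hin
    obtain ⟨f, hf⟩ : ∃ f, polyRep cs (altWord (del₂ cs s t) (i.1.1, M s t)) f ≠ 0 := by
      by_contra! h
      exact polyRep_altWord_ne_zero cs hm i.1.1 (LinearMap.ext h)
    set u := altWord (del₂ cs s t) (nextLetter i.1.1 i.1.2, M s t - i.1.2) with hu
    -- Shorter words have coefficient zero by induction; the other words of at least the same length
    -- are killed by u.
    have h1 := congrFun hg (polyRep cs u f)
    rw [Finset.sum_apply, Finset.sum_eq_single i] at h1
    · rw [Pi.smul_apply, polyEval_apply, ← Module.End.mul_apply, ← map_mul, hu, ← altWord_add,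
        Nat.add_sub_cancel' i.2.1, smul_eq_mul, Pi.zero_apply] at h1
      exact (mul_eq_zero.1 h1).resolve_right hf
    · intro j hj hji
      rw [Pi.smul_apply, polyEval_apply, ← Module.End.mul_apply, ← map_mul]
      rcases lt_or_ge j.1.2 i.1.2 with hlt | hge
      · rw [ih j.1.2 (by omega) j hj rfl, zero_smul]
      · rw [hu, altWord_mul_complement (del₂_mul_self cs) (by omega) (del₂_braid cs) hji hge,
          map_zero, LinearMap.zero_apply, smul_zero]
    · exact fun h => absurd hi h

variable (s t) in
/-- The `R`-submodule of the nil Hecke algebra spanned by the alternating words in `∂_s`, `∂_t`. -/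
def dihedralSpan : Submodule (SymRing cs) (NilHecke cs) :=
  Submodule.span _ (Set.range fun i : WordIndex (M s t) => altWord (del₂ cs s t) i.1)

theorem altWord_mem (hm : 2 ≤ M s t) (b : Bool) (n : ℕ) :
    altWord (del₂ cs s t) (b, n) ∈ dihedralSpan cs s t := by
  rcases lt_or_ge (M s t) n with h | h
  · rw [altWord_eq_zero (del₂_mul_self cs) (by omega) (del₂_braid cs) h]
    exact zero_mem _
  · by_cases h0 : n = 0
    · subst h0
      exact Submodule.subset_span ⟨⟨(true, 0), h, Or.inl rfl⟩, rfl⟩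
    · by_cases h1 : n = M s t
      · subst h1
        rw [altWord_comm (del₂_braid cs) b true]
        exact Submodule.subset_span ⟨⟨(true, M s t), h, Or.inl rfl⟩, rfl⟩
      · exact Submodule.subset_span ⟨⟨(b, n), h, Or.inr ⟨by omega, by omega⟩⟩, rfl⟩

theorem one_mem_dihedralSpan (hm : 2 ≤ M s t) : 1 ∈ dihedralSpan cs s t :=
  altWord_mem cs hm true 0

theorem del_mul_mem (hm : 2 ≤ M s t) (b : Bool) {v : NilHecke cs} (hv : v ∈ dihedralSpan cs s t) :
    del cs (bif b then s else t) * v ∈ dihedralSpan cs s t := by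
  induction hv using Submodule.span_induction with
  | mem v hv =>
    obtain ⟨⟨⟨c, n⟩, hi⟩, rfl⟩ := hv
    change del₂ cs s t b * altWord (del₂ cs s t) (c, n) ∈ _
    by_cases hcb : c = !b
    · rw [hcb, ← altWord_succ]
      exact altWord_mem cs hm _ _
    · obtain rfl : c = b := by cases c <;> cases b <;> simp_all
      rcases n with _ | n
      · have h1 := altWord_mem cs hm c 1
        rwa [altWord_succ] at h1
      · rw [altWord_succ, ← mul_assoc, del₂_mul_self, zero_mul]
        exact zero_mem _
  | zero => rw [mul_zero]; exact zero_mem _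
  | add v v' _ _ hv hv' => rw [mul_add]; exact add_mem hv hv'
  | smul r v hv hv' =>
    rw [del_mul_smul]
    exact add_mem (Submodule.smul_mem _ _ hv') (Submodule.smul_mem _ _ hv)

theorem reflElt_mul_mem (hm : 2 ≤ M s t) (b : Bool) {v : NilHecke cs}
    (hv : v ∈ dihedralSpan cs s t) :
    reflElt cs (bif b then s else t) * v ∈ dihedralSpan cs s t := by
  rw [reflElt_mul]
  exact sub_mem hv (Submodule.smul_mem _ _ (del_mul_mem cs hm b hv))

/-- Faithfulness of the polynomial representation on a rank two span: identities among ∂_s, ∂_t and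
R can be verified on polynomials. -/
theorem eq_zero_of_polyRep_eq_zero (hm : 2 ≤ M s t) {v : NilHecke cs}
    (hv : v ∈ dihedralSpan cs s t) (h : polyRep cs v = 0) : v = 0 := by
  obtain ⟨c, rfl⟩ := Finsupp.mem_span_range_iff_exists_finsupp.1 hv
  suffices hc : c = 0 by simp [hc]
  refine linearIndependent_iff.1 (linearIndependent_altWord cs hm) c ?_
  funext f
  have h' : polyEval cs f _ = 0 := LinearMap.congr_fun h f
  rw [map_finsuppSum] at h'
  rw [Finsupp.linearCombination_apply, Finsupp.sum, Finset.sum_apply]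
  simpa [Finsupp.sum] using h'

theorem reflElt_pow_mem (hm : 2 ≤ M s t) (n : ℕ) :
    (reflElt cs s * reflElt cs t) ^ n ∈ dihedralSpan cs s t := by
  induction n with
  | zero => rw [pow_zero]; exact one_mem_dihedralSpan cs hm
  | succ n ih =>
    rw [pow_succ', mul_assoc]
    exact reflElt_mul_mem cs hm true (reflElt_mul_mem cs hm false ih)

theorem polyRep_reflElt_eq (s : B) :
    polyRep cs (reflElt cs s) = DistribMulAction.toModuleEnd ℝ (SymRing cs) (cs.simple s) :=
  LinearMap.ext fun f => polyRep_reflElt cs s f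

/-- For finite m_{st} with s ≠ t, the element (st)^m - 1 lies in the dihedral span and acts on R by
zero, since s and t act there as the simple reflections of W. -/
theorem reflElt_isLiftable : M.IsLiftable (reflElt cs) := by
  intro s t
  by_cases hst : s = t
  · rw [hst, M.diagonal, pow_one, reflElt_mul_reflElt]
  rcases Nat.eq_zero_or_pos (M s t) with h0 | hpos
  · rw [h0, pow_zero]
  have hm := two_le_of_ne hst hpos.ne'
  refine sub_eq_zero.1 (eq_zero_of_polyRep_eq_zero cs hm
    (sub_mem (reflElt_pow_mem cs hm _) (one_mem_dihedralSpan cs hm)) ?_)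
  rw [map_sub, map_pow, map_mul, map_one, polyRep_reflElt_eq, polyRep_reflElt_eq, ← map_mul,
    ← map_pow, cs.simple_mul_simple_pow, map_one, sub_self]

end DihedralSubalgebra

/-! ### The comultiplication -/

section Comultiplication

/-- Use ∂_s r = s(r)∂_s + ∂_s(r) in the first factor and ∂_s r = ∂_s(r)s + r∂_s in the second. The
error term ∂_s(r)·(1 ⊗ s) then appears on both sides. -/
theorem delTensor_mem (s : B) :
    del cs s ⊗ₜ[SymRing cs] reflElt cs s + 1 ⊗ₜ[SymRing cs] del cs s ∈
      takeuchi (SymRing cs) (NilHecke cs) := by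
  intro r
  have h1 : actR (SymRing cs) (NilHecke cs) (symIncl cs r) 1 (del cs s ⊗ₜ[SymRing cs] reflElt cs s +
      1 ⊗ₜ[SymRing cs] del cs s) =
      ((cs.simple s • r) • del cs s + demazure cs s r • 1) ⊗ₜ[SymRing cs] reflElt cs s +
        (r • 1) ⊗ₜ[SymRing cs] del cs s := by
    rw [map_add, actR_tmul, actR_tmul, del_mul_sym, mul_one, mul_one, one_mul, sym_smul_def,
      ← symIncl_eq_smul_one, ← symIncl_eq_smul_one]
  have h2 : actR (SymRing cs) (NilHecke cs) 1 (symIncl cs r) (del cs s ⊗ₜ[SymRing cs] reflElt cs s +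
      1 ⊗ₜ[SymRing cs] del cs s) =
      del cs s ⊗ₜ[SymRing cs] ((cs.simple s • r) • reflElt cs s) +
        1 ⊗ₜ[SymRing cs] (demazure cs s r • reflElt cs s + r • del cs s) := by
    rw [map_add, actR_tmul, actR_tmul, del_mul_sym', reflElt_mul_sym, mul_one, mul_one]
    rfl
  rw [incl_nh, h1, h2]
  simp only [TensorProduct.add_tmul, TensorProduct.tmul_add, TensorProduct.tmul_smul,
    TensorProduct.smul_tmul']
  abel

/-- The element `∂_s ⊗ s + 1 ⊗ ∂_s` of the Takeuchi product. -/
def delTak (s : B) : takeuchi (SymRing cs) (NilHecke cs) := ⟨_, delTensor_mem cs s⟩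

/-- Substituting s = 1 - α_s ∂_s, both sides are ∂_s ⊗ 1 + 1 ⊗ ∂_s - α_s ∂_s ⊗ ∂_s, which is visibly
symmetric. -/
theorem delTensor_eq (s : B) :
    del cs s ⊗ₜ[SymRing cs] reflElt cs s + 1 ⊗ₜ[SymRing cs] del cs s =
      del cs s ⊗ₜ[SymRing cs] 1 + reflElt cs s ⊗ₜ[SymRing cs] del cs s := by
  rw [reflElt_eq, ← sym_smul_def, TensorProduct.tmul_sub, TensorProduct.sub_tmul,
    TensorProduct.smul_tmul]
  abel

theorem coe_delTak (s : B) : (delTak cs s).1 =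
    del cs s ⊗ₜ[SymRing cs] reflElt cs s + 1 ⊗ₜ[SymRing cs] del cs s := rfl

/-- Multiplication by `∂_s ⊗ s + 1 ⊗ ∂_s` on `H ⊗[R] H`. -/
def delTakMul (s : B) : NilHecke cs ⊗[SymRing cs] NilHecke cs →+
    NilHecke cs ⊗[SymRing cs] NilHecke cs := takMul (delTak cs s).1 (delTak cs s).2

theorem delTak_mul (s : B) (X : takeuchi (SymRing cs) (NilHecke cs)) :
    (delTak cs s * X).1 = delTakMul cs s X.1 := rfl

theorem delTakMul_tmul (s : B) (a b : NilHecke cs) :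
    delTakMul cs s (a ⊗ₜ[SymRing cs] b) =
      (del cs s * a) ⊗ₜ[SymRing cs] (reflElt cs s * b) + a ⊗ₜ[SymRing cs] (del cs s * b) := by
  rw [delTakMul, takMul_tmul, coe_delTak, map_add, actR_tmul, actR_tmul, one_mul]

theorem delTakMul_tmul' (s : B) (a b : NilHecke cs) :
    delTakMul cs s (a ⊗ₜ[SymRing cs] b) =
      (del cs s * a) ⊗ₜ[SymRing cs] b + (reflElt cs s * a) ⊗ₜ[SymRing cs] (del cs s * b) := by
  rw [delTakMul, takMul_tmul, coe_delTak, delTensor_eq, map_add, actR_tmul, actR_tmul, one_mul]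

theorem smul_one_tmul_one_mem (r : SymRing cs) :
    r • ((1 : NilHecke cs) ⊗ₜ[SymRing cs] (1 : NilHecke cs)) ∈
      takeuchi (SymRing cs) (NilHecke cs) := by
  intro r'
  rw [map_smul, map_smul]
  exact congrArg (r • ·) ((1 : takeuchi (SymRing cs) (NilHecke cs)).2 r')

theorem takMul_smul_one (r : SymRing cs) (z : NilHecke cs ⊗[SymRing cs] NilHecke cs) :
    takMul _ (smul_one_tmul_one_mem cs r) z = r • z := by
  induction z with
  | zero => simp
  | tmul a b => simp
  | add x y hx hy => rw [map_add, hx, hy, smul_add]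

/-- The map from `R` to the Takeuchi product. -/
def symTak : SymRing cs →ₐ[ℝ] takeuchi (SymRing cs) (NilHecke cs) where
  toFun r := ⟨_, smul_one_tmul_one_mem cs r⟩
  map_zero' := Subtype.ext (zero_smul _ _)
  map_add' r r' := Subtype.ext (add_smul r r' _)
  map_one' := Subtype.ext (one_smul _ _)
  map_mul' r r' := Subtype.ext ((mul_smul r r' _).trans (takMul_smul_one cs r _).symm)
  commutes' c := Subtype.ext (by
    change algebraMap ℝ (SymRing cs) c • ((1 : NilHecke cs) ⊗ₜ[SymRing cs] (1 : NilHecke cs)) =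
      algebraMap ℝ (NilHecke cs) c ⊗ₜ[SymRing cs] 1
    rw [TensorProduct.smul_tmul', ← symIncl_eq_smul_one, AlgHom.commutes])

theorem coe_symTak (r : SymRing cs) :
    (symTak cs r).1 = r • ((1 : NilHecke cs) ⊗ₜ[SymRing cs] (1 : NilHecke cs)) := rfl

theorem symTak_mul (r : SymRing cs) (X : takeuchi (SymRing cs) (NilHecke cs)) :
    (symTak cs r * X).1 = r • X.1 := takMul_smul_one cs r X.1

theorem delTakMul_smul (s : B) (r : SymRing cs) (z : NilHecke cs ⊗[SymRing cs] NilHecke cs) :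
    delTakMul cs s (r • z) = (cs.simple s • r) • delTakMul cs s z + demazure cs s r • z := by
  induction z with
  | zero => simp
  | tmul a b =>
    rw [TensorProduct.smul_tmul', delTakMul_tmul', delTakMul_tmul', del_mul_smul, reflElt_mul_smul]
    simp only [TensorProduct.add_tmul, smul_add, TensorProduct.smul_tmul']
    abel
  | add x y hx hy => rw [smul_add, map_add, hx, hy, map_add, smul_add, smul_add]; abel

theorem delTak_mul_symTak (s : B) (r : SymRing cs) : delTak cs s * symTak cs r =
    symTak cs (cs.simple s • r) * delTak cs s + symTak cs (demazure cs s r) := by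
  refine Subtype.ext ?_
  have h : delTakMul cs s (1 ⊗ₜ[SymRing cs] 1) = (delTak cs s).1 := by
    rw [delTakMul_tmul, mul_one, mul_one, coe_delTak]
  rw [delTak_mul, coe_symTak, delTakMul_smul, AddSubgroup.coe_add, symTak_mul, coe_symTak, h]

theorem delTak_mul_delTak (s : B) : delTak cs s * delTak cs s = 0 := by
  refine Subtype.ext ?_
  rw [delTak_mul, coe_delTak, map_add, delTakMul_tmul, delTakMul_tmul, del_mul_del,
    del_mul_reflElt, mul_one, reflElt_mul_del, TensorProduct.tmul_neg]
  simp

/-- This is the twisted Leibniz rule ∂_s(pq) = ∂_s(p)q + s(p)∂_s(q) for p = ρ(a)f and q = ρ(b)g. -/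
theorem tensorEval_delTakMul (s : B) (f g : SymRing cs)
    (z : NilHecke cs ⊗[SymRing cs] NilHecke cs) :
    tensorEval (polyEval cs f) (polyEval cs g) (delTakMul cs s z) =
      demazure cs s (tensorEval (polyEval cs f) (polyEval cs g) z) := by
  induction z with
  | zero => simp
  | tmul a b =>
    rw [delTakMul_tmul', map_add, tensorEval_tmul, tensorEval_tmul, tensorEval_tmul, demazure_mul]
    simp only [polyEval_apply, map_mul, Module.End.mul_apply, polyRep_del, polyRep_reflElt]
  | add x y hx hy => simp only [map_add, hx, hy]

theorem tensorEval_altProd (s t : B) (n : ℕ) (f g : SymRing cs) :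
    tensorEval (polyEval cs f) (polyEval cs g) (altProd (delTak cs s) (delTak cs t) n).1 =
      altProd (demazure cs s) (demazure cs t) n (f * g) := by
  induction n generalizing s t with
  | zero =>
    change tensorEval (polyEval cs f) (polyEval cs g) (1 ⊗ₜ[SymRing cs] 1) = f * g
    rw [tensorEval_tmul, polyEval_apply, polyEval_apply, map_one]
    rfl
  | succ n ih =>
    rw [altProd_succ, delTak_mul, tensorEval_delTakMul, ih, altProd_succ, Module.End.mul_apply]

variable {s t : B}

variable (s t) in
/-- The submodule of `H ⊗[R] H` spanned by pairs of alternating words in `∂_s`, `∂_t`. -/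
def dihedralTensor : Submodule (SymRing cs) (NilHecke cs ⊗[SymRing cs] NilHecke cs) :=
  LinearMap.range (TensorProduct.map (dihedralSpan cs s t).subtype (dihedralSpan cs s t).subtype)

theorem tmul_mem_dihedralTensor {a b : NilHecke cs} (ha : a ∈ dihedralSpan cs s t)
    (hb : b ∈ dihedralSpan cs s t) : a ⊗ₜ[SymRing cs] b ∈ dihedralTensor cs s t :=
  ⟨⟨a, ha⟩ ⊗ₜ ⟨b, hb⟩, rfl⟩

theorem dihedralTensor_le : dihedralTensor cs s t ≤ Submodule.span _
    (Set.range fun p : WordIndex (M s t) × WordIndex (M s t) =>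
      altWord (del₂ cs s t) p.1.1 ⊗ₜ[SymRing cs] altWord (del₂ cs s t) p.2.1) := by
  rintro _ ⟨y, rfl⟩
  induction y with
  | zero => rw [map_zero]; exact zero_mem _
  | add x y hx hy => rw [map_add]; exact add_mem hx hy
  | tmul a b =>
    obtain ⟨a, ha⟩ := a
    obtain ⟨b, hb⟩ := b
    have h := Submodule.apply_mem_map₂ (TensorProduct.mk (SymRing cs) (NilHecke cs) (NilHecke cs))
      ha hb
    rw [dihedralSpan, Submodule.map₂_span_span] at h
    refine Submodule.span_mono ?_ h
    rintro _ ⟨_, ⟨i, rfl⟩, _, ⟨j, rfl⟩, rfl⟩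
    exact ⟨(i, j), rfl⟩

theorem delTakMul_mem (hm : 2 ≤ M s t) (b : Bool) {z : NilHecke cs ⊗[SymRing cs] NilHecke cs}
    (hz : z ∈ dihedralTensor cs s t) :
    delTakMul cs (bif b then s else t) z ∈ dihedralTensor cs s t := by
  obtain ⟨y, rfl⟩ := hz
  induction y with
  | zero => rw [map_zero, map_zero]; exact zero_mem _
  | add x y hx hy => rw [map_add, map_add]; exact add_mem hx hy
  | tmul v v' =>
    rw [TensorProduct.map_tmul, delTakMul_tmul]
    exact add_mem
      (tmul_mem_dihedralTensor cs (del_mul_mem cs hm b v.2) (reflElt_mul_mem cs hm b v'.2))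
      (tmul_mem_dihedralTensor cs v.2 (del_mul_mem cs hm b v'.2))

theorem altProd_delTak_mem (hm : 2 ≤ M s t) (b : Bool) (n : ℕ) :
    (altProd (delTak cs (bif b then s else t)) (delTak cs (bif !b then s else t)) n).1 ∈
      dihedralTensor cs s t := by
  induction n generalizing b with
  | zero =>
    exact tmul_mem_dihedralTensor cs (one_mem_dihedralSpan cs hm) (one_mem_dihedralSpan cs hm)
  | succ n ih =>
    have h := delTakMul_mem cs hm b (ih (!b))
    rw [Bool.not_not] at h
    exact h

/-- Both sides lie in the span of tensors of alternating words, where pairs of evaluations detect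
equality. Evaluated at f and g they become alternating products of Demazure operators applied to fg,
which satisfy the braid relation. -/
theorem altProd_delTak_comm (s t : B) :
    altProd (delTak cs s) (delTak cs t) (M s t) = altProd (delTak cs t) (delTak cs s) (M s t) := by
  refine braid_of_ne (d := delTak cs) (fun s t hm => Subtype.ext (sub_eq_zero.1 ?_)) s t
  refine eq_zero_of_tensorEval (linearIndependent_altWord cs hm)
    (dihedralTensor_le cs (sub_mem (altProd_delTak_mem cs hm true _)
      (altProd_delTak_mem cs hm false _))) fun f g => ?_
  rw [map_sub]
  have h1 := tensorEval_altProd cs s t (M s t) f g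
  have h2 := tensorEval_altProd cs t s (M s t) f g
  rw [altProd_demazure_comm] at h1
  exact sub_eq_zero.2 (h1.trans h2.symm)

/-- The comultiplication of the nil Hecke algebra, as an algebra morphism to the Takeuchi
product. -/
def nhComul : NilHecke cs →ₐ[ℝ] takeuchi (SymRing cs) (NilHecke cs) :=
  nhLift cs ((symTak cs).toLinearMap ∘ₗ symι cs) (delTak cs)
    (fun x y => by
      simp only [LinearMap.comp_apply, AlgHom.toLinearMap_apply, ← map_mul, mul_comm])
    (fun s x => by
      have h := delTak_mul_symTak cs s (symι cs x)
      rwa [simple_smul_ι, demazure_ι, AlgHom.commutes] at h)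
    (delTak_mul_delTak cs) (altProd_delTak_comm cs)

theorem nhComul_wt (x : B →₀ ℝ) : nhComul cs (wt cs x) = symTak cs (symι cs x) := nhLift_wt cs x

theorem nhComul_del (s : B) : nhComul cs (del cs s) = delTak cs s := nhLift_del cs s

theorem nhComul_sym (r : SymRing cs) : nhComul cs (symIncl cs r) = symTak cs r := by
  induction r using sym_induction with
  | algebraMap c => rw [AlgHom.commutes, AlgHom.commutes, AlgHom.commutes]
  | ι x => rw [symIncl_ι, nhComul_wt]
  | mul r r' hr hr' => rw [map_mul, map_mul, map_mul, hr, hr']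
  | add r r' hr hr' => rw [map_add, map_add, map_add, hr, hr']

theorem nhComul_smul (r : SymRing cs) (h : NilHecke cs) :
    (nhComul cs (r • h)).1 = r • (nhComul cs h).1 := by
  rw [sym_smul_def, map_mul, nhComul_sym, symTak_mul]

theorem nhComul_del_mul (s : B) (h : NilHecke cs) :
    (nhComul cs (del cs s * h)).1 = delTakMul cs s (nhComul cs h).1 := by
  rw [map_mul, nhComul_del, delTak_mul]

end Comultiplication

end CoxeterSystem

namespace CoxeterSystem

variable {B W : Type*} [Group W] {M : CoxeterMatrix B} (cs : CoxeterSystem M W)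

/-! ### The coalgebra structure -/

section Coalgebra

variable {cs} in
@[elab_as_elim]
theorem nh_induction_sym {p : NilHecke cs → Prop} (h : NilHecke cs) (one : p 1)
    (smul : ∀ (r : SymRing cs) h, p h → p (r • h))
    (del_mul : ∀ s h, p h → p (del cs s * h)) (add : ∀ h h', p h → p h' → p (h + h')) : p h := by
  induction h using nh_induction with
  | one => exact one
  | smul c h hh => rw [← algebraMap_smul (SymRing cs) c h]; exact smul _ _ hh
  | wt_mul x h hh =>
    have := smul (symι cs x) h hh
    rwa [sym_smul_def, symIncl_ι] at this
  | del_mul s h hh => exact del_mul s h hh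
  | add h h' hh hh' => exact add h h' hh hh'

/-- The comultiplication of the nil Hecke algebra as an `R`-linear map. -/
def nhComulₗ : NilHecke cs →ₗ[SymRing cs] NilHecke cs ⊗[SymRing cs] NilHecke cs where
  toFun h := (nhComul cs h).1
  map_add' h h' := by rw [map_add]; rfl
  map_smul' r h := nhComul_smul cs r h

theorem nhComulₗ_apply (h : NilHecke cs) : nhComulₗ cs h = (nhComul cs h).1 := rfl

theorem nhComulₗ_one : nhComulₗ cs 1 = 1 ⊗ₜ[SymRing cs] 1 := by
  rw [nhComulₗ_apply, map_one]
  rfl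

theorem nhComulₗ_del_mul (s : B) (h : NilHecke cs) :
    nhComulₗ cs (del cs s * h) = delTakMul cs s (nhComulₗ cs h) := nhComul_del_mul cs s h

theorem polyEval_one_one : polyEval cs 1 1 = 1 := by
  rw [polyEval_apply, map_one (polyRep cs), Module.End.one_apply]

theorem polyEval_del_mul (s : B) (f : SymRing cs) (h : NilHecke cs) :
    polyEval cs f (del cs s * h) = demazure cs s (polyEval cs f h) := by
  rw [polyEval_apply, map_mul, Module.End.mul_apply, polyRep_del, polyEval_apply]

/-- The operator `h ⊗ n ↦ ∂_s h ⊗ n + s h ⊗ δ(n)`, for a twisted derivation `δ` of an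
`R`-module. -/
def twistedDel (s : B) {N : Type*} [AddCommGroup N] [Module (SymRing cs) N] (δ : N →+ N)
    (hδ : ∀ (r : SymRing cs) n, δ (r • n) = (cs.simple s • r) • δ n + demazure cs s r • n) :
    NilHecke cs ⊗[SymRing cs] N →+ NilHecke cs ⊗[SymRing cs] N :=
  TensorProduct.liftAddHom
    (AddMonoidHom.mk' (fun h => AddMonoidHom.mk'
        (fun n => (del cs s * h) ⊗ₜ[SymRing cs] n + (reflElt cs s * h) ⊗ₜ[SymRing cs] δ n)
        fun n n' => by simp only [map_add, TensorProduct.tmul_add]; abel)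
      fun h h' => AddMonoidHom.ext fun n => by
        simp only [AddMonoidHom.mk'_apply, AddMonoidHom.add_apply, mul_add, TensorProduct.add_tmul]
        abel)
    fun r h n => by
      simp only [AddMonoidHom.mk'_apply]
      rw [hδ, reflElt_mul_smul, del_mul_smul', TensorProduct.tmul_add, TensorProduct.add_tmul]
      simp only [TensorProduct.tmul_smul, TensorProduct.smul_tmul']
      abel

theorem twistedDel_tmul (s : B) {N : Type*} [AddCommGroup N] [Module (SymRing cs) N] (δ : N →+ N)
    (hδ : ∀ (r : SymRing cs) n, δ (r • n) = (cs.simple s • r) • δ n + demazure cs s r • n)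
    (h : NilHecke cs) (n : N) : twistedDel cs s δ hδ (h ⊗ₜ[SymRing cs] n) =
      (del cs s * h) ⊗ₜ[SymRing cs] n + (reflElt cs s * h) ⊗ₜ[SymRing cs] δ n := rfl

/-- The element s is group-like: s ⊗ s = 1 ⊗ 1 - α_s Δ(∂_s). -/
theorem reflElt_tmul_reflElt (s : B) (a b : NilHecke cs) :
    (reflElt cs s * a) ⊗ₜ[SymRing cs] (reflElt cs s * b) =
      a ⊗ₜ[SymRing cs] b - symRoot cs s • delTakMul cs s (a ⊗ₜ[SymRing cs] b) := by
  rw [delTakMul_tmul', reflElt_mul cs s b, TensorProduct.tmul_sub, TensorProduct.tmul_smul,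
    smul_add, sub_add_eq_sub_sub, TensorProduct.smul_tmul' _ (del cs s * a),
    ← TensorProduct.sub_tmul, ← reflElt_mul]

theorem nhComulₗ_reflElt_mul (s : B) (h : NilHecke cs) : nhComulₗ cs (reflElt cs s * h) =
    nhComulₗ cs h - symRoot cs s • delTakMul cs s (nhComulₗ cs h) := by
  rw [reflElt_mul, map_sub, map_smul, nhComulₗ_del_mul]

/-- Coassociativity is proved by showing that both iterated comultiplications turn left
multiplication by ∂_s into one operator on the triple tensor product, ∂_s ⊗ 1 ⊗ 1 + s ⊗ Δ(∂_s). -/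
theorem lTensor_comul_delTakMul (s : B) (y : NilHecke cs ⊗[SymRing cs] NilHecke cs) :
    (nhComulₗ cs).lTensor (NilHecke cs) (delTakMul cs s y) =
      twistedDel cs s (delTakMul cs s) (delTakMul_smul cs s)
        ((nhComulₗ cs).lTensor (NilHecke cs) y) := by
  induction y with
  | zero => simp
  | tmul a b =>
    rw [delTakMul_tmul', map_add, LinearMap.lTensor_tmul, LinearMap.lTensor_tmul,
      LinearMap.lTensor_tmul, twistedDel_tmul, nhComulₗ_del_mul]
  | add x y hx hy => simp only [map_add, hx, hy]

/-- Here Δ(s) = s ⊗ s enters: Δ(∂_s) ⊗ 1 + s ⊗ s ⊗ ∂_s regroups to ∂_s ⊗ 1 ⊗ 1 + s ⊗ Δ(∂_s). -/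
theorem assoc_delTakMul_tmul (s : B) (z : NilHecke cs ⊗[SymRing cs] NilHecke cs)
    (b : NilHecke cs) :
    TensorProduct.assoc (SymRing cs) (NilHecke cs) (NilHecke cs) (NilHecke cs)
      (delTakMul cs s z ⊗ₜ[SymRing cs] b +
        (z - symRoot cs s • delTakMul cs s z) ⊗ₜ[SymRing cs] (del cs s * b)) =
      twistedDel cs s (delTakMul cs s) (delTakMul_smul cs s)
        (TensorProduct.assoc (SymRing cs) (NilHecke cs) (NilHecke cs) (NilHecke cs)
          (z ⊗ₜ[SymRing cs] b)) := by
  induction z with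
  | zero => simp
  | tmul c d =>
    rw [← reflElt_tmul_reflElt, delTakMul_tmul', TensorProduct.assoc_tmul, twistedDel_tmul,
      delTakMul_tmul', TensorProduct.add_tmul, map_add, map_add, TensorProduct.assoc_tmul,
      TensorProduct.assoc_tmul, TensorProduct.assoc_tmul, TensorProduct.tmul_add, add_assoc]
  | add x y hx hy =>
    have h := congrArg₂ (· + ·) hx hy
    simp only [← map_add, ← TensorProduct.add_tmul] at h
    rw [← h]
    congr 1
    simp only [map_add, smul_add, TensorProduct.add_tmul, TensorProduct.sub_tmul]
    abel

theorem rTensor_comul_delTakMul (s : B) (y : NilHecke cs ⊗[SymRing cs] NilHecke cs) :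
    TensorProduct.assoc (SymRing cs) (NilHecke cs) (NilHecke cs) (NilHecke cs)
      ((nhComulₗ cs).rTensor (NilHecke cs) (delTakMul cs s y)) =
      twistedDel cs s (delTakMul cs s) (delTakMul_smul cs s)
        (TensorProduct.assoc (SymRing cs) (NilHecke cs) (NilHecke cs) (NilHecke cs)
          ((nhComulₗ cs).rTensor (NilHecke cs) y)) := by
  induction y with
  | zero => simp
  | tmul a b =>
    rw [delTakMul_tmul', map_add, LinearMap.rTensor_tmul, LinearMap.rTensor_tmul,
      LinearMap.rTensor_tmul, nhComulₗ_del_mul, nhComulₗ_reflElt_mul, assoc_delTakMul_tmul]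
  | add x y hx hy => simp only [map_add, hx, hy]

/-- With r = ε(a), the form ∂_s ⊗ s + 1 ⊗ ∂_s reproduces the rule ∂_s r = ∂_s(r)s + r∂_s. The other
form of Δ(∂_s) plays this role for the right counit. -/
theorem lid_rTensor_counit_delTakMul (s : B) (y : NilHecke cs ⊗[SymRing cs] NilHecke cs) :
    TensorProduct.lid (SymRing cs) (NilHecke cs)
      ((polyEval cs 1).rTensor (NilHecke cs) (delTakMul cs s y)) =
      del cs s * TensorProduct.lid (SymRing cs) (NilHecke cs)
        ((polyEval cs 1).rTensor (NilHecke cs) y) := by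
  induction y with
  | zero => simp
  | tmul a b =>
    rw [delTakMul_tmul, map_add, map_add, LinearMap.rTensor_tmul, LinearMap.rTensor_tmul,
      LinearMap.rTensor_tmul, TensorProduct.lid_tmul, TensorProduct.lid_tmul,
      TensorProduct.lid_tmul, del_mul_smul', polyEval_del_mul]
  | add x y hx hy => simp only [map_add, hx, hy, mul_add]

theorem rid_lTensor_counit_delTakMul (s : B) (y : NilHecke cs ⊗[SymRing cs] NilHecke cs) :
    TensorProduct.rid (SymRing cs) (NilHecke cs)
      ((polyEval cs 1).lTensor (NilHecke cs) (delTakMul cs s y)) =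
      del cs s * TensorProduct.rid (SymRing cs) (NilHecke cs)
        ((polyEval cs 1).lTensor (NilHecke cs) y) := by
  induction y with
  | zero => simp
  | tmul a b =>
    rw [delTakMul_tmul', map_add, map_add, LinearMap.lTensor_tmul, LinearMap.lTensor_tmul,
      LinearMap.lTensor_tmul, TensorProduct.rid_tmul, TensorProduct.rid_tmul,
      TensorProduct.rid_tmul, del_mul_smul', polyEval_del_mul, add_comm]
  | add x y hx hy => simp only [map_add, hx, hy, mul_add]

/-- The flip exchanges the two forms of Δ(∂_s), so cocommutativity is their equality. -/
theorem comm_delTakMul (s : B) (y : NilHecke cs ⊗[SymRing cs] NilHecke cs) :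
    TensorProduct.comm (SymRing cs) (NilHecke cs) (NilHecke cs) (delTakMul cs s y) =
      delTakMul cs s (TensorProduct.comm (SymRing cs) (NilHecke cs) (NilHecke cs) y) := by
  induction y with
  | zero => simp
  | tmul a b =>
    rw [delTakMul_tmul, map_add, TensorProduct.comm_tmul, TensorProduct.comm_tmul,
      TensorProduct.comm_tmul, delTakMul_tmul', add_comm]
  | add x y hx hy => simp only [map_add, hx, hy]

/-- The coalgebra structure of the nil Hecke algebra over `R`. -/
instance nhCoalgebra : Coalgebra (SymRing cs) (NilHecke cs) where
  comul := nhComulₗ cs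
  counit := polyEval cs 1
  coassoc := LinearMap.ext fun h => by
    simp only [LinearMap.comp_apply, LinearEquiv.coe_coe]
    induction h using nh_induction_sym with
    | one => rw [nhComulₗ_one, LinearMap.rTensor_tmul, LinearMap.lTensor_tmul, nhComulₗ_one,
        TensorProduct.assoc_tmul]
    | smul r h hh => rw [map_smul, map_smul, map_smul, map_smul, hh]
    | del_mul s h hh =>
      rw [nhComulₗ_del_mul, rTensor_comul_delTakMul, lTensor_comul_delTakMul, hh]
    | add h h' hh hh' => simp only [map_add, hh, hh']
  rTensor_counit_comp_comul := LinearMap.ext fun h => by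
    apply (TensorProduct.lid (SymRing cs) (NilHecke cs)).injective
    rw [LinearMap.comp_apply, TensorProduct.mk_apply, TensorProduct.lid_tmul, one_smul]
    induction h using nh_induction_sym with
    | one => rw [nhComulₗ_one, LinearMap.rTensor_tmul, TensorProduct.lid_tmul, polyEval_one_one,
        one_smul]
    | smul r h hh => rw [map_smul, map_smul, map_smul, hh]
    | del_mul s h hh => rw [nhComulₗ_del_mul, lid_rTensor_counit_delTakMul, hh]
    | add h h' hh hh' => rw [map_add, map_add, map_add, hh, hh']
  lTensor_counit_comp_comul := LinearMap.ext fun h => by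
    apply (TensorProduct.rid (SymRing cs) (NilHecke cs)).injective
    rw [LinearMap.comp_apply, LinearMap.flip_apply, TensorProduct.mk_apply,
      TensorProduct.rid_tmul, one_smul]
    induction h using nh_induction_sym with
    | one => rw [nhComulₗ_one, LinearMap.lTensor_tmul, TensorProduct.rid_tmul, polyEval_one_one,
        one_smul]
    | smul r h hh => rw [map_smul, map_smul, map_smul, hh]
    | del_mul s h hh => rw [nhComulₗ_del_mul, rid_lTensor_counit_delTakMul, hh]
    | add h h' hh hh' => rw [map_add, map_add, map_add, hh, hh']

theorem nh_comul_eq : Coalgebra.comul (R := SymRing cs) (A := NilHecke cs) = nhComulₗ cs := rfl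

theorem nh_counit_eq : Coalgebra.counit (R := SymRing cs) (A := NilHecke cs) = polyEval cs 1 := rfl

theorem nh_isCocomm : Coalgebra.IsCocomm (SymRing cs) (NilHecke cs) where
  comm_comp_comul := LinearMap.ext fun h => by
    rw [nh_comul_eq, LinearMap.comp_apply, LinearEquiv.coe_coe]
    induction h using nh_induction_sym with
    | one => rw [nhComulₗ_one, TensorProduct.comm_tmul]
    | smul r h hh => rw [map_smul, map_smul, hh]
    | del_mul s h hh => rw [nhComulₗ_del_mul, comm_delTakMul, hh]
    | add h h' hh hh' => rw [map_add, map_add, hh, hh']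

theorem nh_isLeftBialgebroid : IsLeftBialgebroid ℝ (SymRing cs) (NilHecke cs) where
  incl_injective r r' h := by
    -- An element r of R is recovered from its image in NH as ρ(r)(1).
    have h' := congrArg (fun a => polyRep cs a 1) h
    simpa only [incl_nh, polyRep_sym, mul_one] using h'
  comul_algHom := ⟨nhComul cs, fun _ => rfl⟩
  counit_rep := by
    refine ⟨polyRep cs, fun h r => ?_, fun r r' => ?_⟩
    · rw [nh_counit_eq, polyEval_apply, map_mul, Module.End.mul_apply, incl_nh, polyRep_sym,
        mul_one]
    · rw [incl_nh, polyRep_sym]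

end Coalgebra

/-! ### The translation map -/

section TranslationMap

open MulOpposite

/-- Reversing words exchanges the two sides for even m; for odd m each side is a palindrome. -/
theorem altProd_op_comm {A : Type*} [Monoid A] {a b : A} {m : ℕ}
    (h : altProd a b m = altProd b a m) : altProd (op a) (op b) m = altProd (op b) (op a) m := by
  rcases Nat.even_or_odd' m with ⟨n, rfl | rfl⟩
  · rw [altProd_two_mul, altProd_two_mul] at h ⊢
    rw [← op_mul, ← op_mul, ← op_pow, ← op_pow, h]
  · rw [altProd_two_mul_add_one, altProd_two_mul_add_one] at h ⊢
    rw [← op_mul, ← op_mul, ← op_pow, ← op_pow, ← op_mul, ← op_mul, ← mul_pow_mul, ← mul_pow_mul, h]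

theorem coroot_geomReflection (s : B) (x : B →₀ ℝ) :
    coroot M s (geomReflection M s x) = -coroot M s x := by
  rw [geomReflection_apply, map_sub, map_smul, coroot_self, smul_eq_mul]
  ring

theorem geomReflection_geomReflection (s : B) (x : B →₀ ℝ) :
    geomReflection M s (geomReflection M s x) = x := by
  rw [geomReflection_apply M s (geomReflection M s x), coroot_geomReflection, geomReflection_apply]
  module

theorem wt_mul_del (s : B) (x : B →₀ ℝ) : wt cs x * del cs s =
    del cs s * wt cs (geomReflection M s x) + algebraMap ℝ _ (coroot M s x) := by
  rw [del_mul_wt, geomReflection_geomReflection, coroot_geomReflection, map_neg,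
    neg_add_cancel_right]

/-- The anti-automorphism of the nil Hecke algebra which fixes the generators. -/
def nhOp : NilHecke cs →ₐ[ℝ] (NilHecke cs)ᵐᵒᵖ :=
  nhLift cs ((opLinearEquiv ℝ).toLinearMap ∘ₗ wt cs) (fun s => op (del cs s))
    (fun x y => congrArg op (wt_comm cs y x))
    (fun s x => congrArg op (wt_mul_del cs s x))
    (fun s => congrArg op (del_mul_del cs s))
    (fun s t => altProd_op_comm (altProd_del_comm cs s t))

/-- The anti-automorphism of the nil Hecke algebra which fixes the generators, as an additive
map. -/
def nhTr : NilHecke cs →+ NilHecke cs :=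
  (opAddEquiv (α := NilHecke cs)).symm.toAddMonoidHom.comp (nhOp cs).toRingHom.toAddMonoidHom

theorem nhTr_apply (h : NilHecke cs) : nhTr cs h = unop (nhOp cs h) := rfl

theorem nhTr_mul (h h' : NilHecke cs) : nhTr cs (h * h') = nhTr cs h' * nhTr cs h := by
  rw [nhTr_apply, map_mul, unop_mul]; rfl

theorem nhTr_one : nhTr cs 1 = 1 := by rw [nhTr_apply, map_one, unop_one]

theorem nhTr_algebraMap (c : ℝ) : nhTr cs (algebraMap ℝ _ c) = algebraMap ℝ _ c := by
  rw [nhTr_apply, AlgHom.commutes]; rfl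

theorem nhTr_wt (x : B →₀ ℝ) : nhTr cs (wt cs x) = wt cs x := congrArg unop (nhLift_wt cs x)

theorem nhTr_del (s : B) : nhTr cs (del cs s) = del cs s := congrArg unop (nhLift_del cs s)

theorem nhTr_sym (r : SymRing cs) : nhTr cs (symIncl cs r) = symIncl cs r := by
  induction r using sym_induction with
  | algebraMap c => rw [AlgHom.commutes, nhTr_algebraMap]
  | ι x => rw [symIncl_ι, nhTr_wt]
  | mul r r' hr hr' => rw [map_mul, nhTr_mul, hr, hr', ← map_mul, ← map_mul, mul_comm]
  | add r r' hr hr' => rw [map_add, map_add, hr, hr']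

/-- Reversal gives 1 - ∂_s α_s, and ∂_s α_s = 2 - α_s ∂_s. This is where the minus sign in the
second formula for red(∂_s) comes from. -/
theorem nhTr_reflElt (s : B) : nhTr cs (reflElt cs s) = -reflElt cs s := by
  rw [reflElt_eq, map_sub, nhTr_mul, nhTr_one, nhTr_del, nhTr_sym, del_mul_symRoot,
    ← one_add_one_eq_two]
  noncomm_ring

/-- The map `a ⊗ b ↦ τ(a) ⊗ b` from `H ⊗[R] H` to the balanced tensor product, where `τ` is the
anti-automorphism which fixes the generators. -/
def toBal : NilHecke cs ⊗[SymRing cs] NilHecke cs →+ BalTensor (SymRing cs) (NilHecke cs) :=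
  TensorProduct.liftAddHom
    (AddMonoidHom.mk' (fun a => AddMonoidHom.mk'
        (fun b => balTmul (SymRing cs) (NilHecke cs) (nhTr cs a) b)
        fun b b' => balTmul_add_right _ b b')
      fun a a' => AddMonoidHom.ext fun b => by
        simp only [AddMonoidHom.mk'_apply, AddMonoidHom.add_apply, map_add, balTmul_add_left])
    fun r a b => by
      simp only [AddMonoidHom.mk'_apply]
      rw [sym_smul_def, nhTr_mul, nhTr_sym, ← incl_nh, balTmul_balanced]

theorem toBal_tmul (a b : NilHecke cs) : toBal cs (a ⊗ₜ[SymRing cs] b) =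
    balTmul (SymRing cs) (NilHecke cs) (nhTr cs a) b := rfl

theorem toBal_actR (a b : NilHecke cs) (z : NilHecke cs ⊗[SymRing cs] NilHecke cs) :
    toBal cs (actR _ _ a b z) = actB _ _ (nhTr cs a) b (toBal cs z) := by
  induction z with
  | zero => simp
  | tmul h h' => rw [actR_tmul, toBal_tmul, toBal_tmul, actB_balTmul, nhTr_mul]
  | add x y hx hy => simp only [map_add, hx, hy]

theorem toBal_mem {z : NilHecke cs ⊗[SymRing cs] NilHecke cs}
    (hz : z ∈ takeuchi (SymRing cs) (NilHecke cs)) :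
    toBal cs z ∈ balTakeuchi (SymRing cs) (NilHecke cs) := by
  intro r
  have h := congrArg (toBal cs) (hz r)
  rwa [toBal_actR, toBal_actR, nhTr_one, incl_nh, nhTr_sym, ← incl_nh] at h

/-- The map reverses products between the two Takeuchi rings. Combined with the reversal by τ, it
makes τ, then Δ, then this map a genuine algebra morphism. -/
theorem toBal_takMul {x : NilHecke cs ⊗[SymRing cs] NilHecke cs}
    (hx : x ∈ takeuchi (SymRing cs) (NilHecke cs))
    (z : NilHecke cs ⊗[SymRing cs] NilHecke cs) :
    toBal cs (takMul x hx z) = balMul (toBal cs x) (toBal_mem cs hx) (toBal cs z) := by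
  induction z with
  | zero => simp
  | tmul h h' => rw [takMul_tmul, toBal_tmul, toBal_actR, balMul_balTmul]
  | add x y hx hy => simp only [map_add, hx, hy]

/-- The translation map of the nil Hecke algebra, as an algebra morphism. -/
def nhRed : NilHecke cs →ₐ[ℝ] balTakeuchi (SymRing cs) (NilHecke cs) where
  toFun h := ⟨toBal cs (nhComul cs (nhTr cs h)).1, toBal_mem cs (nhComul cs (nhTr cs h)).2⟩
  map_zero' := Subtype.ext (by
    change toBal cs (nhComul cs (nhTr cs 0)).1 = 0
    rw [map_zero, map_zero]
    exact map_zero (toBal cs))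
  map_add' h h' := Subtype.ext (by
    change toBal cs (nhComul cs (nhTr cs (h + h'))).1 =
      toBal cs (nhComul cs (nhTr cs h)).1 + toBal cs (nhComul cs (nhTr cs h')).1
    rw [map_add, map_add, AddSubgroup.coe_add, map_add])
  map_one' := Subtype.ext (by
    change toBal cs (nhComul cs (nhTr cs 1)).1 = balTmul _ _ 1 1
    rw [nhTr_one, map_one]
    exact (toBal_tmul cs 1 1).trans (by rw [nhTr_one]))
  map_mul' h h' := Subtype.ext (by
    change toBal cs (nhComul cs (nhTr cs (h * h'))).1 = balMul _ _ _
    rw [nhTr_mul, map_mul]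
    exact toBal_takMul cs _ _)
  commutes' c := Subtype.ext (by
    change toBal cs (nhComul cs (nhTr cs (algebraMap ℝ _ c))).1 = balTmul _ _ (algebraMap ℝ _ c) 1
    rw [nhTr_algebraMap, AlgHom.commutes]
    exact (toBal_tmul cs _ 1).trans (by rw [nhTr_algebraMap]))

theorem coe_nhRed (h : NilHecke cs) : (nhRed cs h).1 = toBal cs (nhComul cs (nhTr cs h)).1 := rfl

theorem nhRed_sym (r : SymRing cs) :
    (nhRed cs (symIncl cs r)).1 = balTmul (SymRing cs) (NilHecke cs) (symIncl cs r) 1 := by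
  rw [coe_nhRed, nhTr_sym, nhComul_sym, coe_symTak, TensorProduct.smul_tmul', toBal_tmul,
    ← symIncl_eq_smul_one, nhTr_sym]

theorem nhRed_del (s : B) : (nhRed cs (del cs s)).1 =
    balTmul (SymRing cs) (NilHecke cs) (del cs s) (reflElt cs s) +
      balTmul (SymRing cs) (NilHecke cs) 1 (del cs s) := by
  rw [coe_nhRed, nhTr_del, nhComul_del, coe_delTak, map_add, toBal_tmul, toBal_tmul, nhTr_del,
    nhTr_one]

theorem balTmul_neg_left (a b : NilHecke cs) :
    balTmul (SymRing cs) (NilHecke cs) (-a) b = -balTmul (SymRing cs) (NilHecke cs) a b :=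
  TensorProduct.neg_tmul (R := SymRing cs) (toRight (SymRing cs) a) b

theorem nhRed_del' (s : B) : (nhRed cs (del cs s)).1 =
    balTmul (SymRing cs) (NilHecke cs) (del cs s) 1 -
      balTmul (SymRing cs) (NilHecke cs) (reflElt cs s) (del cs s) := by
  rw [coe_nhRed, nhTr_del, nhComul_del, coe_delTak, delTensor_eq, map_add, toBal_tmul, toBal_tmul,
    nhTr_del, nhTr_reflElt, balTmul_neg_left, sub_eq_add_neg]

/-- The translation map as an additive map to the balanced tensor product. -/
def nhRedAdd : NilHecke cs →+ BalTensor (SymRing cs) (NilHecke cs) :=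
  (balTakeuchi (SymRing cs) (NilHecke cs)).subtype.comp (nhRed cs).toRingHom.toAddMonoidHom

theorem nhRedAdd_apply (h : NilHecke cs) : nhRedAdd cs h = (nhRed cs h).1 := rfl

theorem nhRedAdd_mem (h : NilHecke cs) :
    nhRedAdd cs h ∈ balTakeuchi (SymRing cs) (NilHecke cs) := (nhRed cs h).2

theorem nhRedAdd_mul (h h' : NilHecke cs) : nhRedAdd cs (h * h') =
    balMul (nhRedAdd cs h') (nhRedAdd_mem cs h') (nhRedAdd cs h) := by
  rw [nhRedAdd_apply, map_mul]
  rfl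

theorem nhRedAdd_smul (r : SymRing cs) (h : NilHecke cs) : nhRedAdd cs (r • h) =
    actB (SymRing cs) (NilHecke cs) (incl (SymRing cs) (NilHecke cs) r) 1 (nhRedAdd cs h) := by
  rw [sym_smul_def, nhRedAdd_mul, nhRedAdd_apply cs (symIncl cs r), nhRed_sym, balMul_balTmul,
    incl_nh]

theorem nhRedAdd_del_mul (s : B) (h : NilHecke cs) : nhRedAdd cs (del cs s * h) =
    actB (SymRing cs) (NilHecke cs) (del cs s) (reflElt cs s) (nhRedAdd cs h) +
      actB (SymRing cs) (NilHecke cs) 1 (del cs s) (nhRedAdd cs h) := by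
  rw [nhRedAdd_mul, nhRedAdd_apply cs (del cs s), nhRed_del, map_add, balMul_balTmul,
    balMul_balTmul]

theorem nhRedAdd_one : nhRedAdd cs 1 = balTmul (SymRing cs) (NilHecke cs) 1 1 := by
  rw [nhRedAdd_apply, map_one]
  rfl

theorem delTakMul_actR (s : B) (a b : NilHecke cs) (y : NilHecke cs ⊗[SymRing cs] NilHecke cs) :
    delTakMul cs s (actR _ _ a b y) = actR _ _ a b (delTakMul cs s y) := takMul_actR _ _ a b y

theorem galois_actB_del (s : B) (b : NilHecke cs) (x : BalTensor (SymRing cs) (NilHecke cs)) :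
    galois (nh_isLeftBialgebroid cs) (actB _ _ (del cs s) b x) =
      delTakMul cs s (actR _ _ 1 b (galois (nh_isLeftBialgebroid cs) x)) := by
  induction x using bal_induction with
  | zero => simp
  | tmul h h' =>
    rw [actB_balTmul, galois_balTmul, galois_balTmul, actR_actR, nh_comul_eq, nhComulₗ_del_mul,
      delTakMul_actR, one_mul]
  | add x y hx hy => simp only [map_add, hx, hy]

theorem galois_actB_sym (r : SymRing cs) (x : BalTensor (SymRing cs) (NilHecke cs)) :
    galois (nh_isLeftBialgebroid cs) (actB _ _ (incl (SymRing cs) (NilHecke cs) r) 1 x) =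
      r • galois (nh_isLeftBialgebroid cs) x := by
  induction x using bal_induction with
  | zero => simp
  | tmul h h' =>
    rw [actB_balTmul, galois_balTmul, galois_balTmul, incl_mul, map_smul, map_smul, mul_one]
  | add x y hx hy => simp only [map_add, smul_add, hx, hy]

/-- For a factor ∂_s, the Galois map gives ∂_s h ⊗ s² + h ⊗ (∂_s s + ∂_s), which is ∂_s h ⊗ 1 by s²
= 1 and ∂_s s = -∂_s. -/
theorem galois_nhRedAdd (h : NilHecke cs) :
    galois (nh_isLeftBialgebroid cs) (nhRedAdd cs h) = h ⊗ₜ[SymRing cs] 1 := by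
  induction h using nh_induction_sym with
  | one =>
    rw [nhRedAdd_one, galois_balTmul, nh_comul_eq, nhComulₗ_one, actR_tmul, mul_one]
  | smul r h hh => rw [nhRedAdd_smul, galois_actB_sym, hh, TensorProduct.smul_tmul']
  | del_mul s h hh =>
    rw [nhRedAdd_del_mul, map_add, galois_actB_del, galois_actB, hh, actR_tmul, actR_tmul,
      delTakMul_tmul, mul_one, one_mul, one_mul, reflElt_mul_reflElt, del_mul_reflElt,
      TensorProduct.tmul_neg, neg_add_cancel_right]
  | add h h' hh hh' => rw [map_add, map_add, hh, hh', TensorProduct.add_tmul]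

/-- The same cancellation in the opposite direction: the terms with ∂_s in the second factor sum to
(∂_s s + ∂_s)b = 0, and only left multiplication by ∂_s on the first factor remains. -/
theorem translationLift_delTakMul (s : B) (y : NilHecke cs ⊗[SymRing cs] NilHecke cs) :
    translationLift (nhRedAdd cs) (nhRedAdd_mem cs) (nhRedAdd_smul cs) (delTakMul cs s y) =
      actB _ _ (del cs s) 1
        (translationLift (nhRedAdd cs) (nhRedAdd_mem cs) (nhRedAdd_smul cs) y) := by
  induction y with
  | zero => simp
  | tmul a b =>
    have h1 : reflElt cs s * (reflElt cs s * b) = b := by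
      rw [← mul_assoc, reflElt_mul_reflElt, one_mul]
    have h2 : del cs s * (reflElt cs s * b) + del cs s * b = 0 := by
      rw [← mul_assoc, del_mul_reflElt, neg_mul, neg_add_cancel]
    have h3 : actB (SymRing cs) (NilHecke cs) 1 0 (nhRedAdd cs a) = 0 := by
      have := actB_add_right (R := SymRing cs) 1 0 0 (nhRedAdd cs a)
      rwa [add_zero, left_eq_add] at this
    rw [delTakMul_tmul, map_add, translationLift_tmul, translationLift_tmul, translationLift_tmul,
      nhRedAdd_del_mul, map_add, actB_actB, actB_actB, actB_actB, one_mul, one_mul, mul_one,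
      mul_one, h1, add_assoc, ← actB_add_right, h2, h3, add_zero]
  | add x y hx hy => simp only [map_add, hx, hy]

theorem translationLift_smul (r : SymRing cs) (y : NilHecke cs ⊗[SymRing cs] NilHecke cs) :
    translationLift (nhRedAdd cs) (nhRedAdd_mem cs) (nhRedAdd_smul cs) (r • y) =
      actB _ _ (incl (SymRing cs) (NilHecke cs) r) 1
        (translationLift (nhRedAdd cs) (nhRedAdd_mem cs) (nhRedAdd_smul cs) y) := by
  induction y with
  | zero => simp
  | tmul a b =>
    rw [TensorProduct.smul_tmul', translationLift_tmul, translationLift_tmul, nhRedAdd_smul,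
      actB_actB, actB_actB, one_mul, one_mul, mul_one, mul_one]
  | add x y hx hy => rw [smul_add, map_add, map_add, map_add, hx, hy]

theorem translationLift_comul (h : NilHecke cs) :
    translationLift (nhRedAdd cs) (nhRedAdd_mem cs) (nhRedAdd_smul cs) (nhComulₗ cs h) =
      balTmul (SymRing cs) (NilHecke cs) h 1 := by
  induction h using nh_induction_sym with
  | one => rw [nhComulₗ_one, translationLift_tmul, nhRedAdd_one, actB_balTmul, one_mul]
  | smul r h hh => rw [map_smul, translationLift_smul, hh, actB_balTmul, mul_one, incl_mul]
  | del_mul s h hh => rw [nhComulₗ_del_mul, translationLift_delTakMul, hh, actB_balTmul, mul_one]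
  | add h h' hh hh' => rw [map_add, map_add, hh, hh', balTmul_add_left]

theorem nh_isHopfAlgebroid : IsHopfAlgebroid ℝ (SymRing cs) (NilHecke cs) where
  toIsLeftBialgebroid := nh_isLeftBialgebroid cs
  galois_bijective := galois_bijective_of_translation (nhRedAdd cs) (nhRedAdd_mem cs)
    (nhRedAdd_smul cs) _ (galois_nhRedAdd cs) (translationLift_comul cs)

end TranslationMap

/-! ### The twisted group algebra as a Hopf subalgebroid -/

section Subalgebroid

open SkewMonoidAlgebra

/-- The morphism from `W` to the nil Hecke algebra with `s ↦ 1 - α_s ∂_s`. -/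
def groupElt : W →* NilHecke cs := cs.lift ⟨reflElt cs, reflElt_isLiftable cs⟩

theorem groupElt_simple (s : B) : groupElt cs (cs.simple s) = reflElt cs s :=
  cs.lift_apply_simple (reflElt_isLiftable cs) s

theorem groupElt_simple_mul (s : B) (w : W) :
    groupElt cs (cs.simple s * w) = reflElt cs s * groupElt cs w := by
  rw [map_mul, groupElt_simple]

theorem groupElt_mul_sym (w : W) (r : SymRing cs) :
    groupElt cs w * symIncl cs r = symIncl cs (w • r) * groupElt cs w := by
  induction w using cs.simple_induction_left with
  | one => rw [map_one, one_mul, one_smul, mul_one]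
  | mul_simple_left w s hw =>
    rw [groupElt_simple_mul, mul_assoc, hw, ← mul_assoc, reflElt_mul_sym, mul_assoc, mul_smul]

theorem polyRep_groupElt (w : W) (f : SymRing cs) : polyRep cs (groupElt cs w) f = w • f := by
  induction w using cs.simple_induction_left with
  | one => rw [map_one, map_one, one_smul, Module.End.one_apply]
  | mul_simple_left w s hw =>
    rw [groupElt_simple_mul, map_mul, Module.End.mul_apply, hw, polyRep_reflElt, mul_smul]

theorem nhComulₗ_groupElt (w : W) :
    nhComulₗ cs (groupElt cs w) = groupElt cs w ⊗ₜ[SymRing cs] groupElt cs w := by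
  induction w using cs.simple_induction_left with
  | one => rw [map_one, nhComulₗ_one]
  | mul_simple_left w s hw =>
    rw [groupElt_simple_mul, nhComulₗ_reflElt_mul, hw, reflElt_tmul_reflElt]

/-- The algebra morphism from the twisted group algebra to the nil Hecke algebra. -/
def twistedIncl : SkewMonoidAlgebra (SymRing cs) W →ₐ[ℝ] NilHecke cs :=
  liftNCAlgHom (symIncl cs) (groupElt cs) fun {r w} => (groupElt_mul_sym cs w r).symm

theorem twistedIncl_single (w : W) (r : SymRing cs) :
    twistedIncl cs (single w r) = r • groupElt cs w :=
  liftNC_single _ _ w r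

theorem twistedIncl_smul (r : SymRing cs) (a : SkewMonoidAlgebra (SymRing cs) W) :
    twistedIncl cs (r • a) = r • twistedIncl cs a := by
  induction a using SkewMonoidAlgebra.induction_on with
  | zero => simp
  | single w r' => rw [SkewMonoidAlgebra.smul_single, twistedIncl_single, twistedIncl_single,
      smul_eq_mul, mul_smul]
  | add a b ha hb => rw [smul_add, map_add, map_add, smul_add, ha, hb]

/-- In the nil Coxeter module, `w e_1` is a nonzero multiple of `e_w` plus a combination of `e_v`
for elements `v` shorter than `w`. -/
theorem nilRep_groupElt (w : W) :
    nilRep cs (groupElt cs w) (Finsupp.single 1 1) w ≠ 0 ∧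
      ∀ v, v ≠ w → cs.length w ≤ cs.length v →
        nilRep cs (groupElt cs w) (Finsupp.single 1 1) v = 0 := by
  induction hn : cs.length w generalizing w with
  | zero =>
    obtain rfl := cs.length_eq_zero_iff.1 hn
    refine ⟨?_, fun v hv _ => ?_⟩
    · rw [map_one (groupElt cs), map_one (nilRep cs), Module.End.one_apply,
        Finsupp.single_eq_same]
      exact one_ne_zero
    · rw [map_one (groupElt cs), map_one (nilRep cs), Module.End.one_apply,
        Finsupp.single_eq_of_ne hv]
  | succ n ih =>
    obtain ⟨s, hs⟩ := cs.exists_leftDescent_of_ne_one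
      (w := w) (fun h => by rw [h, cs.length_one] at hn; omega)
    rw [cs.isLeftDescent_iff] at hs
    obtain ⟨u, rfl⟩ : ∃ u, w = cs.simple s * u :=
      ⟨cs.simple s * w, (cs.simple_mul_simple_cancel_left s).symm⟩
    rw [cs.simple_mul_simple_cancel_left] at hs
    obtain ⟨h1, h2⟩ := ih u (by omega)
    rw [groupElt_simple_mul, map_mul (nilRep cs)]
    simp only [Module.End.mul_apply, nilRep_reflElt_apply]
    refine ⟨?_, fun v hv hle => ?_⟩
    -- At su, which is longer than u, the diagonal term vanishes by induction; what is left is -α_s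
    -- times s applied to the nonzero coefficient of u e_1 at u.
    · rw [cs.simple_mul_simple_cancel_left, if_pos hs.symm,
        h2 (cs.simple s * u) (fun h => by rw [h] at hs; omega) (by omega), smul_zero, zero_sub]
      refine neg_ne_zero.2 (mul_ne_zero (symRoot_ne_zero cs s) ?_)
      rwa [smul_ne_zero_iff_ne]
    -- Here v is longer than u, while sv differs from u and is at least as long as u, so both
    -- coefficients that can contribute vanish by induction.
    · have h3 := cs.length_simple_mul v s
      rw [h2 v (fun h => by rw [h] at hle; omega) (by omega), smul_zero, zero_sub,
        h2 (cs.simple s * v) (fun h => hv (by rw [← h, cs.simple_mul_simple_cancel_left]))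
          (by omega), smul_zero, mul_zero, ite_self, neg_zero]

/-- Triangularity with respect to length: act on e_1 in the nil Coxeter module and look at the
coordinate of a longest element w of the support. No other element of the support reaches it, and R
is a domain. -/
theorem twistedIncl_injective : Function.Injective (twistedIncl cs) := by
  refine (injective_iff_map_eq_zero _).2 fun a ha => ?_
  by_contra hne
  obtain ⟨w, hw, hmax⟩ := a.support.exists_max_image cs.length
    (Finset.nonempty_iff_ne_empty.2 fun h => hne (support_eq_empty.1 h))
  have h1 := congrArg (fun h => nilRep cs h (Finsupp.single 1 1) w) ha
  have h2 : twistedIncl cs a = ∑ v ∈ a.support, a.coeff v • groupElt cs v := by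
    conv_lhs => rw [← SkewMonoidAlgebra.sum_single a, sum_def', _root_.map_sum]
    exact Finset.sum_congr rfl fun v _ => twistedIncl_single cs v _
  simp only [h2, _root_.map_sum, LinearMap.sum_apply, Finsupp.finsetSum_apply, map_zero,
    LinearMap.zero_apply, Finsupp.zero_apply, sym_smul_def, map_mul, Module.End.mul_apply,
    nilRep_sym, Finsupp.smul_apply] at h1
  rw [Finset.sum_eq_single w
    (fun v hv hvw => by rw [(nilRep_groupElt cs v).2 w hvw.symm (hmax v hv), smul_zero])
    (fun h => absurd hw h), smul_eq_mul] at h1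
  exact (mul_ne_zero (mem_support_iff.1 hw) (nilRep_groupElt cs w).1) h1

theorem twistedIncl_isHopfSubalgebroid : IsHopfSubalgebroid (R := SymRing cs) (twistedIncl cs) where
  isHopfAlgebroid := twisted_isHopfAlgebroid
  injective := twistedIncl_injective cs
  map_smul := twistedIncl_smul cs
  map_comul a := by
    induction a using SkewMonoidAlgebra.induction_on with
    | zero => simp
    | single w r =>
      rw [comul_single, TensorProduct.map_tmul, nh_comul_eq]
      change nhComulₗ cs (twistedIncl cs (single w r)) =
        twistedIncl cs (single w r) ⊗ₜ twistedIncl cs (single w 1)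
      rw [twistedIncl_single, twistedIncl_single, one_smul, map_smul, nhComulₗ_groupElt,
        TensorProduct.smul_tmul']
    | add a b ha hb => rw [map_add, map_add, map_add, map_add, ha, hb]
  map_counit a := by
    induction a using SkewMonoidAlgebra.induction_on with
    | zero => simp
    | single w r =>
      rw [counit_single, twistedIncl_single, nh_counit_eq, map_smul, polyEval_apply,
        polyRep_groupElt, smul_one, smul_eq_mul, mul_one]
    | add a b ha hb => rw [map_add, map_add, map_add, ha, hb]

end Subalgebroid

end CoxeterSystem

end

/-! ### The nil Hecke Hopf algebroid -/

theorem mainTheorem1 {B W : Type*} [Group W] {M : CoxeterMatrix B} (cs : CoxeterSystem M W) :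
    ∃ (ρ : NilHecke cs →ₐ[ℝ] Module.End ℝ (SymRing cs))
      (Δ : NilHecke cs →ₐ[ℝ] takeuchi (SymRing cs) (NilHecke cs))
      (_ : Coalgebra (SymRing cs) (NilHecke cs))
      (hH : IsHopfAlgebroid ℝ (SymRing cs) (NilHecke cs))
      (red : NilHecke cs →ₐ[ℝ] balTakeuchi (SymRing cs) (NilHecke cs))
      (j : SkewMonoidAlgebra (SymRing cs) W →ₐ[ℝ] NilHecke cs),
      -- the polynomial representation
      (∀ x f, ρ (wt cs x) f = symι cs x * f) ∧
      (∀ s f, symι cs (simpleRoot s) * ρ (del cs s) f = f - cs.simple s • f) ∧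
      -- the comultiplication
      (∀ x, (Δ (wt cs x)).1 = symι cs x • (1 ⊗ₜ[SymRing cs] 1)) ∧
      (∀ s, (Δ (del cs s)).1 = del cs s ⊗ₜ[SymRing cs] reflElt cs s + 1 ⊗ₜ[SymRing cs] del cs s) ∧
      (∀ s, (Δ (del cs s)).1 = del cs s ⊗ₜ[SymRing cs] 1 + reflElt cs s ⊗ₜ[SymRing cs] del cs s) ∧
      -- the cocommutative Hopf algebroid
      (∀ h, Coalgebra.comul (R := SymRing cs) h = (Δ h).1) ∧
      (∀ h, Coalgebra.counit (R := SymRing cs) h = ρ h 1) ∧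
      Coalgebra.IsCocomm (SymRing cs) (NilHecke cs) ∧
      -- the translation map
      (∀ h, hH.red h = (red h).1) ∧
      (∀ x, (red (wt cs x)).1 = balTmul (SymRing cs) (NilHecke cs) (wt cs x) 1) ∧
      (∀ s, (red (del cs s)).1 = balTmul (SymRing cs) (NilHecke cs) (del cs s) (reflElt cs s) +
        balTmul (SymRing cs) (NilHecke cs) 1 (del cs s)) ∧
      (∀ s, (red (del cs s)).1 = balTmul (SymRing cs) (NilHecke cs) (del cs s) 1 -
        balTmul (SymRing cs) (NilHecke cs) (reflElt cs s) (del cs s)) ∧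
      -- the Hopf subalgebroid
      (∀ s, j (SkewMonoidAlgebra.single (cs.simple s) 1) = reflElt cs s) ∧
      IsHopfSubalgebroid (R := SymRing cs) j := by
  refine ⟨polyRep cs, nhComul cs, nhCoalgebra cs, nh_isHopfAlgebroid cs, nhRed cs, twistedIncl cs,
    fun x f => ?_, fun s f => ?_, fun x => ?_, fun s => ?_, fun s => ?_, fun _ => rfl,
    fun _ => rfl, nh_isCocomm cs, fun h => ?_, fun x => ?_, nhRed_del cs, nhRed_del' cs,
    fun s => ?_, twistedIncl_isHopfSubalgebroid cs⟩
  · rw [polyRep_wt, symMulι_apply]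
  · rw [polyRep_del]
    exact symRoot_mul_demazure cs s f
  · rw [nhComul_wt, coe_symTak]
  · rw [nhComul_del, coe_delTak]
  · rw [nhComul_del, coe_delTak, delTensor_eq]
  · exact IsHopfAlgebroid.red_eq_of_galois_eq _ (galois_nhRedAdd cs h)
  · rw [← symIncl_ι, nhRed_sym]
  · rw [twistedIncl_single, groupElt_simple, one_smul]
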